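/- Let $n\ge 1$, let $M\in\mathbb R^{n\times n}$ be symmetric, $q\in\mathbb R^n$ and $u\in(0,\infty]^n$, and consider the quadratic program $$\text{(QP)}\qquad \min_{0\le x\le u}\ \theta(x)=q^\top x+\tfrac12x^\top Mx .$$ The comparison matrix $\overline M$ of $M$ has entries $\overline M_{ii}=m_{ii}$ and $\overline M_{ij}=-|m_{ij}|$ for $i\ne j$. The matrix $M$ is irreducible if no permutation matrix $P$ brings $PMP^\top$ to the form $\begin{bmatrix}B&0\\C&D\end{bmatrix}$ with square nonempty blocks $B,D$. **The algorithm (PPPA)** for a vector $p\in\mathbb R^n$. It works with a partition $(\alpha,\beta,\gamma)$ of $[n]=\{1,\dots,n\}$, initially $(\emptyset,[n],\emptyset)$. In each iteration it computes $\bar p_\alpha=M_{\alpha\alpha}^{-1}p_\alpha$, $\bar q_\alpha=M_{\alpha\alpha}^{-1}(q_\alpha+M_{\alpha\gamma}u_\gamma)$ and, for $i\notin\alpha$, $\bar p_i=p_i-M_{i\alpha}\bar p_\alpha$, $\bar q_i=q_i+M_{i\gamma}u_\gamma-M_{i\alpha}\bar q_\alpha$, and then $$\tau=\max\Big(\{0\}\cup\big\{-\tfrac{\bar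 q_i}{\bar p_i}: i\in\beta,\ \bar p_i>0\big\}\cup\big\{-\tfrac{u_i+\bar q_i}{\bar p_i}: i\in\alpha,\ \bar p_i>0,\ u_i<\infty\big\}\Big).$$ If $\tau=0$, it stops and returns $(x_\alpha,x_\beta,x_\gamma)=(-\bar q_\alpha,0,u_\gamma)$. Otherwise it chooses an index $i$ attaining the maximum (ties here and below are broken arbitrarily) and pivots: 1. if $i\in\alpha$, then $i$ moves from $\alpha$ to $\gamma$; 2. if $i\in\beta$, let $\hat m=M_{\alpha\alpha}^{-1}M_{\alpha i}$ and $\sigma=m_{ii}-M_{i\alpha}\hat m$ (the Schur complement entry). - (2a) If $\sigma>0$, then $i$ moves from $\beta$ to $\alpha$. - (2b) If $\sigma=0$, let $\rho$ be the minimum of the numbers $\frac{-\bar q_j-\tau\bar p_j}{\hat m_j}$ ($j\in\alpha$, $\hat m_j>0$), $\frac{u_j+\bar q_j+\tau\bar p_j}{-\hat m_j}$ ($j\in\alpha$, $u_j<\infty$, $\hat m_j<0$), and $u_i$ if $u_i<\infty$. If there are none ($\rho=\infty$), it stops and reports that (QP) has no finite optimal solution. Otherwise, if $\rho=u_i$,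 then $i$ moves from $\beta$ to $\gamma$; if $\rho$ is attained by an index $j$ of the first (second) family, then $i$ moves from $\beta$ to $\alpha$ and $j$ moves from $\alpha$ to $\beta$ (to $\gamma$). **Theorem.** Suppose that $M$ is irreducible and $\overline M$ is positive semidefinite, let $d>0$ satisfy $\overline Md=0$, put $p=Md$, and suppose that $q+\tau_0p\ge0$ for some $\tau_0>0$. Then, however ties are broken, the PPPA is well defined (each $M_{\alpha\alpha}$ that occurs is nonsingular, and the algorithm never gets stuck), all its pivots are of the kinds (1) and (2a), and after at most $2n$ pivots it stops. If it stops with a vector $x$, then $x$ is an optimal solution of (QP); if it stops with the report that (QP) has no finite optimal solution, then (QP) has none and $\theta$ is unbounded below on the box. Moreover the PPPA has overall complexity $O(n^3)$: there are a single program of a random access machine with unit-cost real arithmetic and comparisons, and a constant $C$, such that for all $n\ge1$ and all data $M,q,u,d$ as above the program carries out a complete run of the PPPA (recording its partitions $(\alpha,\beta,\gamma)$ and its result) in at most $Cn^3$ steps. -/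

import Mathlib

namespace PPPA

/-! ### Matrices -/

/-- The comparison matrix: same diagonal, off-diagonal entries `-|m_ij|`. -/
def comparison {n : ℕ} (M : Matrix (Fin n) (Fin n) ℝ) : Matrix (Fin n) (Fin n) ℝ :=
  Matrix.of fun i j => if i = j then M i i else -|M i j|

/-- `A` is irreducible: no simultaneous permutation of rows and columns brings `A` to the form
`[B 0; C D]` with square diagonal blocks `B` (of order `k`, `0 < k < n`) and `D`. -/
def IsIrreducible {n : ℕ} (A : Matrix (Fin n) (Fin n) ℝ) : Prop :=
  ¬ ∃ (e : Equiv.Perm (Fin n)) (k : ℕ), 0 < k ∧ k < n ∧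
    ∀ i j : Fin n, (i : ℕ) < k → k ≤ (j : ℕ) → A.submatrix e e i j = 0

/-! ### The box-constrained quadratic program

Upper bounds lie in `EReal`, so that `u i = ⊤` means that there is no upper bound on `x i`. -/

/-- The objective `q^T x + (1/2) x^T M x`. -/
noncomputable def objective {n : ℕ} (M : Matrix (Fin n) (Fin n) ℝ) (q : Fin n → ℝ)
    (x : Fin n → ℝ) : ℝ :=
  q ⬝ᵥ x + (1 / 2) * (x ⬝ᵥ M.mulVec x)

/-- The box `0 ≤ x ≤ u`. -/
def box {n : ℕ} (u : Fin n → EReal) : Set (Fin n → ℝ) :=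
  {x | ∀ i, 0 ≤ x i ∧ (x i : EReal) ≤ u i}

/-- `x` is an optimal solution of the quadratic program. -/
def IsOptimal {n : ℕ} (M : Matrix (Fin n) (Fin n) ℝ) (q : Fin n → ℝ) (u : Fin n → EReal)
    (x : Fin n → ℝ) : Prop :=
  x ∈ box u ∧ ∀ y ∈ box u, objective M q x ≤ objective M q y

/-! ### The parametric principal pivoting algorithm -/

/-- The position of a variable: nonbasic at its lower bound (index set `β`), basic
(index set `α`), or nonbasic at its upper bound (index set `γ`). -/
inductive Pos
  | lower
  | basic
  | upper
  deriving DecidableEq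

/-- A triple `(α, β, γ)` of index sets that partition `[n]`. -/
abbrev Status (n : ℕ) : Type := Fin n → Pos

/-- Initially `α = γ = ∅` and `β = [n]`. -/
def initial (n : ℕ) : Status n := fun _ => Pos.lower

/-- The principal submatrix `M_αα`. -/
def basicBlock {n : ℕ} (M : Matrix (Fin n) (Fin n) ℝ) (s : Status n) :
    Matrix {i : Fin n // s i = Pos.basic} {i : Fin n // s i = Pos.basic} ℝ :=
  M.submatrix Subtype.val Subtype.val

/-- The vector with `α`-part `M_αα⁻¹ v_α` and with zeros elsewhere. -/
noncomputable def basicSolve {n : ℕ} (M : Matrix (Fin n) (Fin n) ℝ) (s : Status n)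
    (v : Fin n → ℝ) : Fin n → ℝ := fun i =>
  if h : s i = Pos.basic then ((basicBlock M s)⁻¹.mulVec fun j => v j.val) ⟨i, h⟩ else 0

/-- The update of a vector: `v̄_α = M_αα⁻¹ v_α`, and `v̄_i = v_i - M_iα M_αα⁻¹ v_α` for
`i ∉ α`. -/
noncomputable def bar {n : ℕ} (M : Matrix (Fin n) (Fin n) ℝ) (s : Status n)
    (v : Fin n → ℝ) : Fin n → ℝ := fun i =>
  if s i = Pos.basic then basicSolve M s v i else v i - ∑ j, M i j * basicSolve M s v j

/-- The vector `q̄`: the update of `q + M_{·γ} u_γ`. -/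
noncomputable def qbar {n : ℕ} (M : Matrix (Fin n) (Fin n) ℝ) (q : Fin n → ℝ)
    (u : Fin n → EReal) (s : Status n) : Fin n → ℝ :=
  bar M s fun i => q i + ∑ j, if s j = Pos.upper then M i j * (u j).toReal else 0

/-- The column `m̂_{αi} = M_αα⁻¹ M_αi` (with zeros outside `α`). -/
noncomputable def mhat {n : ℕ} (M : Matrix (Fin n) (Fin n) ℝ) (s : Status n) (i : Fin n) :
    Fin n → ℝ :=
  basicSolve M s fun j => M j i

/-- The diagonal entry `(M / M_αα)_ii` of the Schur complement, for `i ∉ α`. -/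
noncomputable def schurDiag {n : ℕ} (M : Matrix (Fin n) (Fin n) ℝ) (s : Status n)
    (i : Fin n) : ℝ :=
  M i i - ∑ j, M i j * mhat M s i j

/-- `i ∈ β` competes in the first ratio test with the ratio `t = -q̄_i / p̄_i`. -/
def LowerRatio {n : ℕ} (M : Matrix (Fin n) (Fin n) ℝ) (q p : Fin n → ℝ) (u : Fin n → EReal)
    (s : Status n) (i : Fin n) (t : ℝ) : Prop :=
  s i = Pos.lower ∧ 0 < bar M s p i ∧ t = -(qbar M q u s i / bar M s p i)

/-- `i ∈ α` competes in the first ratio test with the ratio `t = -(u_i + q̄_i) / p̄_i`. -/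
def UpperRatio {n : ℕ} (M : Matrix (Fin n) (Fin n) ℝ) (q p : Fin n → ℝ) (u : Fin n → EReal)
    (s : Status n) (i : Fin n) (t : ℝ) : Prop :=
  s i = Pos.basic ∧ 0 < bar M s p i ∧ u i < ⊤ ∧
    t = -(((u i).toReal + qbar M q u s i) / bar M s p i)

/-- `t` is the new critical value `τ_new` of the parameter: the maximum of `0` and of all
ratios of the first ratio test. -/
def IsCritical {n : ℕ} (M : Matrix (Fin n) (Fin n) ℝ) (q p : Fin n → ℝ) (u : Fin n → EReal)
    (s : Status n) (t : ℝ) : Prop :=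
  IsGreatest ({0} ∪ {r | ∃ i, LowerRatio M q p u s i r} ∪ {r | ∃ i, UpperRatio M q p u s i r}) t

/-- `j ∈ α` competes in the second ratio test by falling to `0`, with ratio `r`. -/
def DownRatio {n : ℕ} (M : Matrix (Fin n) (Fin n) ℝ) (q p : Fin n → ℝ) (u : Fin n → EReal)
    (s : Status n) (t : ℝ) (i j : Fin n) (r : ℝ) : Prop :=
  s j = Pos.basic ∧ 0 < mhat M s i j ∧
    r = (-qbar M q u s j - t * bar M s p j) / mhat M s i j

/-- `j ∈ α` competes in the second ratio test by rising to `u_j`, with ratio `r`. -/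
def UpRatio {n : ℕ} (M : Matrix (Fin n) (Fin n) ℝ) (q p : Fin n → ℝ) (u : Fin n → EReal)
    (s : Status n) (t : ℝ) (i j : Fin n) (r : ℝ) : Prop :=
  s j = Pos.basic ∧ u j < ⊤ ∧ mhat M s i j < 0 ∧
    r = ((u j).toReal + qbar M q u s j + t * bar M s p j) / (-mhat M s i j)

/-- All candidates of the second ratio test, including `u_i` if finite; the minimum is
`ρ_min`, with `ρ_min = ∞` if there is no candidate. -/
def secondRatios {n : ℕ} (M : Matrix (Fin n) (Fin n) ℝ) (q p : Fin n → ℝ) (u : Fin n → EReal)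
    (s : Status n) (t : ℝ) (i : Fin n) : Set ℝ :=
  {r | ∃ j, DownRatio M q p u s t i j r} ∪ {r | ∃ j, UpRatio M q p u s t i j r} ∪
    {r | u i < ⊤ ∧ r = (u i).toReal}

/-- Names of the five kinds of pivots. -/
inductive Kind
  /-- diagonal pivot, `i` moves from `α` to `γ` -/
  | toUpper
  /-- diagonal pivot, `i` moves from `β` to `α` -/
  | enter
  /-- `2 × 2` pivot, `i` moves from `β` to `γ` -/
  | jump
  /-- `2 × 2` pivot, `i` moves from `β` to `α` and `j` from `α` to `β` -/
  | swapDown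
  /-- `2 × 2` pivot, `i` moves from `β` to `α` and `j` from `α` to `γ` -/
  | swapUp

/-- `Pivot M q p u k s s'`: the algorithm may perform a pivot of kind `k` at the index triple
`s`, with resulting index triple `s'`. Ties are broken arbitrarily. -/
inductive Pivot {n : ℕ} (M : Matrix (Fin n) (Fin n) ℝ) (q p : Fin n → ℝ) (u : Fin n → EReal) :
    Kind → Status n → Status n → Prop
  | toUpper (s : Status n) (t : ℝ) (i : Fin n) :
      IsCritical M q p u s t → 0 < t → UpperRatio M q p u s i t →
      Pivot M q p u Kind.toUpper s (Function.update s i Pos.upper)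
  | enter (s : Status n) (t : ℝ) (i : Fin n) :
      IsCritical M q p u s t → 0 < t → LowerRatio M q p u s i t → 0 < schurDiag M s i →
      Pivot M q p u Kind.enter s (Function.update s i Pos.basic)
  | jump (s : Status n) (t : ℝ) (i : Fin n) :
      IsCritical M q p u s t → 0 < t → LowerRatio M q p u s i t → schurDiag M s i = 0 →
      u i < ⊤ → IsLeast (secondRatios M q p u s t i) (u i).toReal →
      Pivot M q p u Kind.jump s (Function.update s i Pos.upper)
  | swapDown (s : Status n) (t : ℝ) (i j : Fin n) (r : ℝ) :
      IsCritical M q p u s t → 0 < t → LowerRatio M q p u s i t → schurDiag M s i = 0 →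
      DownRatio M q p u s t i j r → IsLeast (secondRatios M q p u s t i) r →
      Pivot M q p u Kind.swapDown s
        (Function.update (Function.update s i Pos.basic) j Pos.lower)
  | swapUp (s : Status n) (t : ℝ) (i j : Fin n) (r : ℝ) :
      IsCritical M q p u s t → 0 < t → LowerRatio M q p u s i t → schurDiag M s i = 0 →
      UpRatio M q p u s t i j r → IsLeast (secondRatios M q p u s t i) r →
      Pivot M q p u Kind.swapUp s
        (Function.update (Function.update s i Pos.basic) j Pos.upper)

/-- The algorithm stops and reports a solution: `τ_new = 0`. -/
def StopsOptimal {n : ℕ} (M : Matrix (Fin n) (Fin n) ℝ) (q p : Fin n → ℝ) (u : Fin n → EReal)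
    (s : Status n) : Prop :=
  IsCritical M q p u s 0

/-- The solution `(x_α, x_β, x_γ) = (-q̄_α, 0, u_γ)` that is reported. -/
noncomputable def solution {n : ℕ} (M : Matrix (Fin n) (Fin n) ℝ) (q : Fin n → ℝ)
    (u : Fin n → EReal) (s : Status n) : Fin n → ℝ := fun i =>
  match s i with
  | Pos.basic => -qbar M q u s i
  | Pos.lower => 0
  | Pos.upper => (u i).toReal

/-- The algorithm stops and reports that there is no finite optimal solution: a `2 × 2` pivot
is called for, and `ρ_min = ∞`. -/
def StopsUnbounded {n : ℕ} (M : Matrix (Fin n) (Fin n) ℝ) (q p : Fin n → ℝ)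
    (u : Fin n → EReal) (s : Status n) : Prop :=
  ∃ t i, IsCritical M q p u s t ∧ 0 < t ∧ LowerRatio M q p u s i t ∧ schurDiag M s i = 0 ∧
    secondRatios M q p u s t i = ∅

/-- `σ 0, …, σ N` are the index triples of `N` successive pivots of the algorithm. -/
def IsRun {n : ℕ} (M : Matrix (Fin n) (Fin n) ℝ) (q p : Fin n → ℝ) (u : Fin n → EReal)
    (N : ℕ) (σ : ℕ → Status n) : Prop :=
  σ 0 = initial n ∧ ∀ k < N, ∃ κ, Pivot M q p u κ (σ k) (σ (k + 1))

/-! ### A random access machine with real arithmetic at unit cost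

A program is a finite text, the same for all dimensions. Every arithmetic operation, every
comparison, every memory access, every assignment and every pass through a loop costs one
step. -/

/-- The memory: natural-number registers, two-dimensional arrays of natural numbers and
two-dimensional arrays of real numbers. -/
structure Mem where
  reg : ℕ → ℕ
  nat : ℕ → ℕ → ℕ → ℕ
  real : ℕ → ℕ → ℕ → ℝ

/-- Assignment to a register. -/
def Mem.setReg (m : Mem) (v k : ℕ) : Mem :=
  { m with reg := Function.update m.reg v k }

/-- Assignment to the entry `(i, j)` of a natural-number array. -/
def Mem.setNat (m : Mem) (a i j k : ℕ) : Mem :=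
  { m with
    nat := Function.update m.nat a
      (Function.update (m.nat a) i (Function.update (m.nat a i) j k)) }

/-- Assignment to the entry `(i, j)` of a real array. -/
def Mem.setReal (m : Mem) (a i j : ℕ) (x : ℝ) : Mem :=
  { m with
    real := Function.update m.real a
      (Function.update (m.real a) i (Function.update (m.real a i) j x)) }

/-- Natural-number expressions. -/
inductive NExp
  | const (k : ℕ)
  | reg (v : ℕ)
  | get (a : ℕ) (i j : NExp)
  | add (e f : NExp)
  | sub (e f : NExp)

/-- Value of a natural-number expression (subtraction is truncated). -/
def NExp.eval (m : Mem) : NExp → ℕ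
  | .const k => k
  | .reg v => m.reg v
  | .get a i j => m.nat a (i.eval m) (j.eval m)
  | .add e f => e.eval m + f.eval m
  | .sub e f => e.eval m - f.eval m

/-- Cost of a natural-number expression. -/
def NExp.cost : NExp → ℕ
  | .const _ => 1
  | .reg _ => 1
  | .get _ i j => i.cost + j.cost + 1
  | .add e f => e.cost + f.cost + 1
  | .sub e f => e.cost + f.cost + 1

/-- Real expressions; the only constants are `0` and `1`. -/
inductive RExp
  | zero
  | one
  | get (a : ℕ) (i j : NExp)
  | add (e f : RExp)
  | sub (e f : RExp)
  | mul (e f : RExp)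
  | div (e f : RExp)

/-- Value of a real expression. -/
noncomputable def RExp.eval (m : Mem) : RExp → ℝ
  | .zero => 0
  | .one => 1
  | .get a i j => m.real a (i.eval m) (j.eval m)
  | .add e f => e.eval m + f.eval m
  | .sub e f => e.eval m - f.eval m
  | .mul e f => e.eval m * f.eval m
  | .div e f => e.eval m / f.eval m

/-- Cost of a real expression. -/
def RExp.cost : RExp → ℕ
  | .zero => 1
  | .one => 1
  | .get _ i j => i.cost + j.cost + 1
  | .add e f => e.cost + f.cost + 1
  | .sub e f => e.cost + f.cost + 1
  | .mul e f => e.cost + f.cost + 1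
  | .div e f => e.cost + f.cost + 1

/-- Tests. -/
inductive Test
  | natEq (e f : NExp)
  | natLt (e f : NExp)
  | realLt (e f : RExp)
  | neg (b : Test)
  | and (b c : Test)

/-- Truth of a test. -/
def Test.holds (m : Mem) : Test → Prop
  | .natEq e f => e.eval m = f.eval m
  | .natLt e f => e.eval m < f.eval m
  | .realLt e f => e.eval m < f.eval m
  | .neg b => ¬ b.holds m
  | .and b c => b.holds m ∧ c.holds m

/-- Cost of a test. -/
def Test.cost : Test → ℕ
  | .natEq e f => e.cost + f.cost + 1
  | .natLt e f => e.cost + f.cost + 1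
  | .realLt e f => e.cost + f.cost + 1
  | .neg b => b.cost + 1
  | .and b c => b.cost + c.cost + 1

/-- Programs. `loop v e c` evaluates `e` once and then runs `c` with register `v` set to
`0, 1, …, e - 1` in turn. -/
inductive Prog
  | skip
  | setReg (v : ℕ) (e : NExp)
  | setNat (a : ℕ) (i j e : NExp)
  | setReal (a : ℕ) (i j : NExp) (e : RExp)
  | seq (c d : Prog)
  | ite (b : Test) (c d : Prog)
  | loop (v : ℕ) (e : NExp) (c : Prog)

/-- Apply `f 0`, then `f 1`, …, then `f (N - 1)`. -/
def iterate (f : ℕ → Mem → Mem) : ℕ → Mem → Mem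
  | 0, m => m
  | N + 1, m => f N (iterate f N m)

open Classical in
/-- The memory after the execution of a program. -/
noncomputable def Prog.exec : Prog → Mem → Mem
  | .skip, m => m
  | .setReg v e, m => m.setReg v (e.eval m)
  | .setNat a i j e, m => m.setNat a (i.eval m) (j.eval m) (e.eval m)
  | .setReal a i j e, m => m.setReal a (i.eval m) (j.eval m) (e.eval m)
  | .seq c d, m => d.exec (c.exec m)
  | .ite b c d, m => if b.holds m then c.exec m else d.exec m
  | .loop v e c, m => iterate (fun k m' => c.exec (m'.setReg v k)) (e.eval m) m

open Classical in
/-- The number of steps of the execution of a program. -/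
noncomputable def Prog.cost : Prog → Mem → ℕ
  | .skip, _ => 1
  | .setReg _ e, _ => e.cost + 1
  | .setNat _ i j e, _ => i.cost + j.cost + e.cost + 1
  | .setReal _ i j e, _ => i.cost + j.cost + e.cost + 1
  | .seq c d, m => c.cost m + d.cost (c.exec m)
  | .ite b c d, m => b.cost + (if b.holds m then c.cost m else d.cost m) + 1
  | .loop v e c, m => e.cost + 1 + ∑ k ∈ Finset.range (e.eval m),
      (c.cost ((iterate (fun k' m' => c.exec (m'.setReg v k')) k m).setReg v k) + 1)

/-! ### Input and output of an implementation of the algorithm -/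

/-- A vector as the first column of a real array, with zeros elsewhere. -/
noncomputable def vecArray {n : ℕ} (v : Fin n → ℝ) : ℕ → ℕ → ℝ := fun i j =>
  if h : i < n ∧ j = 0 then v ⟨i, h.1⟩ else 0

/-- A matrix as a real array, with zeros elsewhere. -/
noncomputable def matArray {n : ℕ} (M : Matrix (Fin n) (Fin n) ℝ) : ℕ → ℕ → ℝ := fun i j =>
  if h : i < n ∧ j < n then M ⟨i, h.1⟩ ⟨j, h.2⟩ else 0

open Classical in
/-- The memory at the start: register `0` holds `n`, the real arrays `0`, `1`, `2`, `3` hold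
`M`, `q`, `d` and the finite entries of `u`, and the natural-number array `0` marks by `1` the
indices `i` with `u i < ∞`. Everything else is `0`. -/
noncomputable def inputMem {n : ℕ} (M : Matrix (Fin n) (Fin n) ℝ) (q d : Fin n → ℝ)
    (u : Fin n → EReal) : Mem where
  reg := fun v => if v = 0 then n else 0
  nat := fun a i j => if h : a = 0 ∧ i < n ∧ j = 0 then
    (if u ⟨i, h.2.1⟩ < ⊤ then 1 else 0) else 0
  real := fun a => match a with
    | 0 => matArray M
    | 1 => vecArray q
    | 2 => vecArray d
    | 3 => vecArray fun i => (u i).toReal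
    | _ => fun _ _ => 0

/-- Numbers that stand for the three positions. -/
def Pos.code : Pos → ℕ
  | .lower => 0
  | .basic => 1
  | .upper => 2

/-- The memory `m` at the end documents a complete run of the algorithm: register `1` holds the
number `N` of pivots, row `k ≤ N` of the natural-number array `1` holds the index triple after
`k` pivots, and either register `2` holds `0`, the run ends with a solution and real array `4`
holds this solution, or register `2` holds `1` and the run ends with the report that there is
no finite optimal solution. -/
def Documents {n : ℕ} (M : Matrix (Fin n) (Fin n) ℝ) (q p : Fin n → ℝ) (u : Fin n → EReal)
    (m : Mem) : Prop :=
  ∃ σ : ℕ → Status n, IsRun M q p u (m.reg 1) σ ∧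
    (∀ k ≤ m.reg 1, ∀ i : Fin n, m.nat 1 k i = (σ k i).code) ∧
    ((m.reg 2 = 0 ∧ StopsOptimal M q p u (σ (m.reg 1)) ∧
        ∀ i : Fin n, m.real 4 i 0 = solution M q u (σ (m.reg 1)) i) ∨
      (m.reg 2 = 1 ∧ StopsUnbounded M q p u (σ (m.reg 1))))

end PPPA

namespace PPPA

open Matrix

variable {n : ℕ}

/-! ### The comparison matrix -/

/-! Write `A` for the comparison matrix. Entrywise comparison gives `xᵀMx ≥ |x|ᵀA|x| ≥ 0`, so `M` is
positive semidefinite. If `xᵀMx = 0` and some `x_k = 0`, then `A|x| = 0`, and irreducibility spreads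
the zero over all coordinates (`comparison_eq_zero`, `eq_zero`). Hence `M_αα` is nonsingular for
every proper subset `α`.

The rest hinges on two sign facts about `p = Md`. The first is `p̄ ≥ 0` (`bar_nonneg`): since `Ad =
0`, a maximum principle for `A` yields `|p̄_α - d_α| ≤ d_α`. The second is that `p̄_i > 0` forces a
positive Schur complement entry (`schurDiag_pos`). So the `2 × 2` pivots and the report of
unboundedness never occur, and `M_αα` stays nonsingular even when `α` becomes `[n]`.

As `τ` decreases, `p̄ ≥ 0` means that basic variables can only rise and that the gradient entries at
nonbasic indices can only fall. The ratio test watches exactly the bounds that can be violated in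
this way, so the optimality conditions for `q + τp` persist (`IsKKT.of_isCritical`). Each pivot
moves one index one step along `β → α → γ`, which allows at most `2n` pivots. At `τ = 0` the
optimality conditions suffice, by convexity.

For the complexity, a tableau with `n` rows and `n + 2` columns is updated in `O(n²)` operations per
iteration. `IsTableau` describes it by a linear identity that exchange steps preserve, and the
running time is read off from the nesting of loops (`Prog.IsPoly.cost_le`). -/

theorem comparison_mulVec_le (M : Matrix (Fin n) (Fin n) ℝ) {g h : Fin n → ℝ} {i : Fin n}
    (hg : ∀ j, |g j| ≤ h j) (hi : g i = h i) : (comparison M *ᵥ h) i ≤ (M *ᵥ g) i := by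
  simp only [mulVec, dotProduct]
  refine Finset.sum_le_sum fun j _ => ?_
  by_cases hij : i = j
  · subst hij
    simp [comparison, hi]
  · simp only [comparison, of_apply, hij, if_false]
    have h1 : |M i j * g j| ≤ |M i j| * h j := by
      rw [abs_mul]
      exact mul_le_mul_of_nonneg_left (hg j) (abs_nonneg _)
    have h2 := neg_abs_le (M i j * g j)
    linarith

theorem comparison_mulVec_abs_le (M : Matrix (Fin n) (Fin n) ℝ) (e : Fin n → ℝ) (i : Fin n) :
    (comparison M *ᵥ fun j => |e j|) i ≤ |(M *ᵥ e) i| := by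
  rcases le_total 0 (e i) with h | h
  · exact (comparison_mulVec_le M (fun j => le_rfl) (abs_of_nonneg h).symm).trans (le_abs_self _)
  · have h1 := comparison_mulVec_le M (g := -e) (h := fun j => |e j|) (i := i)
      (fun j => by simp) (by simp [abs_of_nonpos h])
    rw [mulVec_neg] at h1
    exact h1.trans (neg_le_abs _)

theorem comparison_quadratic_abs_le (M : Matrix (Fin n) (Fin n) ℝ) (x : Fin n → ℝ) :
    (fun j => |x j|) ⬝ᵥ (comparison M *ᵥ fun j => |x j|) ≤ x ⬝ᵥ (M *ᵥ x) := by
  simp only [dotProduct, mulVec, Finset.mul_sum]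
  refine Finset.sum_le_sum fun i _ => Finset.sum_le_sum fun j _ => ?_
  by_cases hij : i = j
  · subst hij
    simp only [comparison, of_apply, if_true]
    exact le_of_eq (by linear_combination M i i * abs_mul_abs_self (x i))
  · simp only [comparison, of_apply, hij, if_false]
    have h2 := neg_abs_le (x i * (M i j * x j))
    rw [abs_mul, abs_mul] at h2
    linarith

/-- Irreducibility in terms of index sets. -/
theorem IsIrreducible.eq_univ {M : Matrix (Fin n) (Fin n) ℝ} (h : IsIrreducible M)
    (S : Finset (Fin n)) (hS : S.Nonempty) (h0 : ∀ i ∈ S, ∀ j ∉ S, M i j = 0) :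
    S = Finset.univ := by
  by_contra hne
  have hk : S.card < n := by
    simpa using (Finset.card_lt_iff_ne_univ S).2 hne
  have hcard : Fintype.card {i : Fin n // (i : ℕ) < S.card} = Fintype.card {i // i ∈ S} := by
    rw [Fintype.card_subtype, Fintype.card_coe]
    rw [Fin.card_filter_val_lt, min_eq_right hk.le]
  refine h ⟨(Fintype.equivOfCardEq hcard).extendSubtype, S.card, hS.card_pos, hk,
    fun i j hi hj => h0 _ (Equiv.extendSubtype_mem _ i hi) _
      (Equiv.extendSubtype_not_mem _ j (not_lt.2 hj))⟩

/-! ### Definiteness of `M` and the role of irreducibility -/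

/-- The standing assumptions on the matrix `M` and the vector `d`. -/
structure Admissible (M : Matrix (Fin n) (Fin n) ℝ) (d : Fin n → ℝ) : Prop where
  symm : M.IsSymm
  psd : (comparison M).PosSemidef
  irred : IsIrreducible M
  pos : ∀ i, 0 < d i
  ker : comparison M *ᵥ d = 0

variable {M : Matrix (Fin n) (Fin n) ℝ} {d q : Fin n → ℝ} {u : Fin n → EReal}

/-- Semidefiniteness gives `Ay = 0`. In a row `i` with `y_i = 0` this reads `∑ |m_ij| y_j = 0`, so
`m_ij = 0` wherever `y_j > 0`. The nonempty zero set of `y` therefore splits off a block and must be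
everything. -/
theorem Admissible.comparison_eq_zero (h : Admissible M d) {y : Fin n → ℝ} (hy : ∀ i, 0 ≤ y i)
    (hq : y ⬝ᵥ (comparison M *ᵥ y) ≤ 0) {k : Fin n} (hk : y k = 0) : y = 0 := by
  have hnn := h.psd.dotProduct_mulVec_nonneg y
  simp only [star_trivial] at hnn
  have h0 : comparison M *ᵥ y = 0 := by
    rw [← h.psd.dotProduct_mulVec_zero_iff]
    simpa using le_antisymm hq hnn
  have hS := h.irred.eq_univ (Finset.univ.filter fun i => y i = 0) ⟨k, by simp [hk]⟩ (by
    intro i hi j hj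
    simp only [Finset.mem_filter, Finset.mem_univ, true_and] at hi hj
    have hij : i ≠ j := by
      rintro rfl
      exact hj hi
    have hle : ∀ l, 0 ≤ -(comparison M i l * y l) := by
      intro l
      by_cases hil : i = l
      · subst hil
        simp [hi]
      · simp only [comparison, of_apply, hil, if_false]
        have := mul_nonneg (abs_nonneg (M i l)) (hy l)
        linarith
    have hsum : ∑ l, -(comparison M i l * y l) = 0 := by
      have := congrFun h0 i
      simp only [mulVec, dotProduct, Pi.zero_apply] at this
      simp [this]
    have := (Finset.sum_eq_zero_iff_of_nonneg fun l _ => hle l).1 hsum j (Finset.mem_univ j)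
    simpa [comparison, hij, hj] using this)
  funext i
  have : i ∈ Finset.univ.filter fun i => y i = 0 := by simp [hS]
  simpa using this

theorem Admissible.quadratic_nonneg (h : Admissible M d) (x : Fin n → ℝ) :
    0 ≤ x ⬝ᵥ (M *ᵥ x) := by
  have h1 := h.psd.dotProduct_mulVec_nonneg fun j => |x j|
  have h2 := comparison_quadratic_abs_le M x
  have h3 : star (fun j => |x j|) = fun j => |x j| := star_trivial _
  rw [h3] at h1
  linarith

theorem Admissible.posSemidef (h : Admissible M d) : M.PosSemidef :=
  .of_dotProduct_mulVec_nonneg (by simpa [IsHermitian, IsSymm] using h.symm)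
    fun x => by simpa using h.quadratic_nonneg x

theorem Admissible.mulVec_eq_zero (h : Admissible M d) {x : Fin n → ℝ}
    (hx : x ⬝ᵥ (M *ᵥ x) = 0) : M *ᵥ x = 0 :=
  (h.posSemidef.dotProduct_mulVec_zero_iff x).1 (by simpa using hx)

theorem Admissible.eq_zero (h : Admissible M d) {x : Fin n → ℝ}
    (hx : x ⬝ᵥ (M *ᵥ x) = 0) {k : Fin n} (hk : x k = 0) : x = 0 := by
  have := h.comparison_eq_zero (y := fun j => |x j|) (fun _ => abs_nonneg _)
    ((comparison_quadratic_abs_le M x).trans hx.le) (k := k) (by simp [hk])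
  funext i
  simpa using congrFun this i

theorem dotProduct_mulVec_symm (h : M.IsSymm) (x y : Fin n → ℝ) :
    x ⬝ᵥ (M *ᵥ y) = y ⬝ᵥ (M *ᵥ x) := by
  rw [dotProduct_mulVec, ← mulVec_transpose, h.eq, dotProduct_comm]

/-! ### Linear systems with the basic block -/

/-- Unique solvability of the systems with the matrix `M_αα`. -/
abbrev Regular (M : Matrix (Fin n) (Fin n) ℝ) (s : Status n) : Prop :=
  IsUnit (basicBlock M s).det

theorem mulVec_eq_sum_basic (M : Matrix (Fin n) (Fin n) ℝ) {s : Status n} {x : Fin n → ℝ}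
    (hx : ∀ i, s i ≠ Pos.basic → x i = 0) (i : Fin n) :
    (M *ᵥ x) i = ∑ j : {i : Fin n // s i = Pos.basic}, M i j * x j := by
  rw [← Finset.sum_subtype (Finset.univ.filter fun i => s i = Pos.basic) (by simp)
    fun j => M i j * x j]
  symm
  apply Finset.sum_filter_of_ne
  intro j _ hj
  by_contra hsj
  exact hj (by simp [hx j hsj])

/-- Vectors on `α` are handled throughout as vectors on `[n]` that vanish off `α`; this criterion
keeps the subtype of `basicBlock` out of later arguments. -/
theorem regular_iff (M : Matrix (Fin n) (Fin n) ℝ) (s : Status n) :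
    Regular M s ↔ ∀ x : Fin n → ℝ, (∀ i, s i ≠ Pos.basic → x i = 0) →
      (∀ i, s i = Pos.basic → (M *ᵥ x) i = 0) → x = 0 := by
  rw [Regular, isUnit_iff_ne_zero, Ne, ← exists_mulVec_eq_zero_iff]
  push Not
  constructor
  · intro h x hx h0
    by_contra hne
    refine h (fun j => x j) (fun h' => hne ?_) ?_
    · funext i
      by_cases hi : s i = Pos.basic
      · exact congrFun h' ⟨i, hi⟩
      · exact hx i hi
    · funext i
      rw [Pi.zero_apply, ← h0 i i.2, mulVec_eq_sum_basic M hx]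
      rfl
  · intro h v hv h0
    refine hv ?_
    have hx : ∀ i, s i ≠ Pos.basic →
        (fun i => if h : s i = Pos.basic then v ⟨i, h⟩ else 0) i = 0 := fun i hi => by simp [hi]
    have := h _ hx (fun i hi => by
      rw [mulVec_eq_sum_basic M hx]
      refine Eq.trans ?_ (congrFun h0 ⟨i, hi⟩)
      refine Finset.sum_congr rfl fun j _ => ?_
      simp [basicBlock, j.2])
    funext i
    simpa [i.2] using congrFun this i

theorem basicSolve_of_ne {s : Status n} {v : Fin n → ℝ} {i : Fin n} (hi : s i ≠ Pos.basic) :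
    basicSolve M s v i = 0 := by
  simp [basicSolve, hi]

theorem mulVec_basicSolve {s : Status n} (hs : Regular M s) (v : Fin n → ℝ) {i : Fin n}
    (hi : s i = Pos.basic) : (M *ᵥ basicSolve M s v) i = v i := by
  rw [mulVec_eq_sum_basic M fun i hi => basicSolve_of_ne hi]
  have := congrFun (congrArg (fun B => B *ᵥ fun j => v j.val) (mul_nonsing_inv _ hs)) ⟨i, hi⟩
  simp only [← mulVec_mulVec, one_mulVec] at this
  rw [← this]
  refine Finset.sum_congr rfl fun j _ => ?_
  simp [basicSolve, basicBlock, j.2]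

theorem bar_of_basic {s : Status n} {v : Fin n → ℝ} {i : Fin n} (hi : s i = Pos.basic) :
    bar M s v i = basicSolve M s v i := by
  simp [bar, hi]

theorem bar_of_ne {s : Status n} {v : Fin n → ℝ} {i : Fin n} (hi : s i ≠ Pos.basic) :
    bar M s v i = v i - (M *ᵥ basicSolve M s v) i := by
  simp [bar, hi, mulVec, dotProduct]

theorem schurDiag_eq (M : Matrix (Fin n) (Fin n) ℝ) (s : Status n) (i : Fin n) :
    schurDiag M s i = (M *ᵥ (Pi.single i 1 - mhat M s i)) i := by
  rw [mulVec_sub, Pi.sub_apply, mulVec_single_one]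
  rfl

theorem mulVec_single_sub_mhat {s : Status n} (hs : Regular M s) {i j : Fin n}
    (hj : s j = Pos.basic) : (M *ᵥ (Pi.single i 1 - mhat M s i)) j = 0 := by
  rw [mulVec_sub, Pi.sub_apply, mhat, mulVec_basicSolve hs _ hj]
  simp

/-- A null vector of `M_αα`, extended by zeros, satisfies `xᵀMx = 0` and vanishes at `k`. -/
theorem Admissible.regular (h : Admissible M d) {s : Status n} {k : Fin n}
    (hk : s k ≠ Pos.basic) : Regular M s := by
  rw [regular_iff]
  intro x hx h0
  refine h.eq_zero (Finset.sum_eq_zero fun i _ => ?_) (hx k hk)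
  by_cases hi : s i = Pos.basic
  · simp [h0 i hi]
  · simp [hx i hi]

/-- Vectors supported on `α ∪ {i}` that `M` annihilates on `α` are multiples of `z = e_i - m̂`, and
the `i`-th entry of `Mz` is the Schur complement entry. -/
theorem Regular.update_basic {s : Status n} (hs : Regular M s) {i : Fin n}
    (hi : s i ≠ Pos.basic) (hσ : schurDiag M s i ≠ 0) :
    Regular M (Function.update s i Pos.basic) := by
  rw [regular_iff]
  intro x hx h0
  have hx' : ∀ j, j ≠ i → s j ≠ Pos.basic → x j = 0 := fun j hj hsj =>
    hx j (by rwa [Function.update_of_ne hj])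
  have hb : ∀ j, s j = Pos.basic → j ≠ i := by
    rintro j hj rfl
    exact hi hj
  have hxz : x - x i • (Pi.single i 1 - mhat M s i) = 0 := by
    refine (regular_iff M s).1 hs _ (fun j hj => ?_) (fun j hj => ?_)
    · by_cases hji : j = i
      · subst hji
        simp [mhat, basicSolve_of_ne hj]
      · simp [mhat, basicSolve_of_ne hj, hx' j hji hj, hji]
    · rw [mulVec_sub, mulVec_smul, Pi.sub_apply, Pi.smul_apply, mulVec_single_sub_mhat hs hj,
        h0 j (by rw [Function.update_of_ne (hb j hj)]; exact hj)]
      simp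
  rw [sub_eq_zero] at hxz
  have hxi : x i = 0 := by
    have h1 := h0 i (by simp)
    rw [hxz, mulVec_smul, Pi.smul_apply, ← schurDiag_eq, smul_eq_mul] at h1
    exact (mul_eq_zero.1 h1).resolve_right hσ
  rw [hxz, hxi, zero_smul]

/-! ### Signs of the Schur complement entries and of `p̄` -/

/-- The residual of the vector `e_i - m̂_i`: for every `v`, its product with `v - M M_αα⁻¹ v_α`
is `v̄_i`. -/
theorem dotProduct_residual {s : Status n} (hs : Regular M s) (v : Fin n → ℝ) {i : Fin n}
    (hi : s i ≠ Pos.basic) :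
    (Pi.single i 1 - mhat M s i) ⬝ᵥ (v - M *ᵥ basicSolve M s v) = bar M s v i := by
  rw [bar_of_ne hi, dotProduct, Finset.sum_eq_single i]
  · simp [mhat, basicSolve_of_ne hi]
  · intro j _ hji
    by_cases hj : s j = Pos.basic
    · simp [mulVec_basicSolve hs v hj]
    · simp [mhat, basicSolve_of_ne hj, hji]
  · simp

/-- With `z = e_i - m̂`, the Schur complement entry is `zᵀMz ≥ 0`. If it were `0`, then `Mz = 0`,
and `p̄_i = zᵀM(d - b) = 0` by symmetry, where `b` is the zero extension of `p̄_α`. -/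
theorem Admissible.schurDiag_pos (h : Admissible M d) {s : Status n} (hs : Regular M s)
    {i : Fin n} (hi : s i ≠ Pos.basic) (hp : 0 < bar M s (M *ᵥ d) i) : 0 < schurDiag M s i := by
  set z : Fin n → ℝ := Pi.single i 1 - mhat M s i with hz
  have hzz : z ⬝ᵥ (M *ᵥ z) = schurDiag M s i := by
    rw [dotProduct, Finset.sum_eq_single i]
    · rw [schurDiag_eq]
      simp [hz, mhat, basicSolve_of_ne hi]
    · intro j _ hji
      by_cases hj : s j = Pos.basic
      · rw [hz, mulVec_single_sub_mhat hs hj, mul_zero]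
      · simp [hz, mhat, basicSolve_of_ne hj, hji]
    · simp
  refine lt_of_le_of_ne (hzz ▸ h.quadratic_nonneg z) fun h0 => hp.ne' ?_
  have hMz := h.mulVec_eq_zero (hzz.trans h0.symm)
  rw [← dotProduct_residual hs _ hi, ← hz, ← mulVec_sub, dotProduct_mulVec_symm h.symm, hMz,
    dotProduct_zero]

/-- The basic part of `p̄` differs from `d` by at most `d`. -/
theorem Admissible.abs_basicSolve_sub_le (h : Admissible M d) {s : Status n} (hs : Regular M s)
    (i : Fin n) (hi : s i = Pos.basic) : |basicSolve M s (M *ᵥ d) i - d i| ≤ d i := by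
  set b := basicSolve M s (M *ᵥ d) with hb
  -- If `α = [n]`, there is no coordinate at which the comparison argument below could find a zero;
  -- but then `p̄ = d`.
  by_cases hall : ∀ k, s k = Pos.basic
  · have : b - d = 0 := by
      refine (regular_iff M s).1 hs _ (fun j hj => absurd (hall j) hj) (fun j hj => ?_)
      rw [mulVec_sub, Pi.sub_apply, hb, mulVec_basicSolve hs _ hj, sub_self]
    have := congrFun this i
    simp only [Pi.sub_apply, Pi.zero_apply] at this
    rw [this, abs_zero]
    exact (h.pos i).le
  push Not at hall
  obtain ⟨k, hk⟩ := hall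
  set dα : Fin n → ℝ := fun i => if s i = Pos.basic then d i else 0 with hdα
  set e : Fin n → ℝ := b - dα with he
  set f : Fin n → ℝ := fun i => |e i| - dα i with hf
  have hoff : ∀ j, s j ≠ Pos.basic → f j = 0 := by
    intro j hj
    simp [hf, he, hdα, hb, basicSolve_of_ne hj, hj]
  -- on the basic indices the image of `f` under the comparison matrix is nonpositive
  have hAf : ∀ j, s j = Pos.basic → (comparison M *ᵥ f) j ≤ 0 := by
    intro j hj
    have h1 := comparison_mulVec_abs_le M e j
    have h2 : (M *ᵥ e) j = (M *ᵥ (d - dα)) j := by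
      rw [he, mulVec_sub, mulVec_sub, Pi.sub_apply, Pi.sub_apply, hb, mulVec_basicSolve hs _ hj]
    -- Because `Ad = 0`, this bound equals `(A d_α)_j` and cancels against the term `-d_α` of `f`.
    have h3 : |(M *ᵥ (d - dα)) j| ≤ -(comparison M *ᵥ (d - dα)) j := by
      rw [mulVec, dotProduct, mulVec, dotProduct, ← Finset.sum_neg_distrib]
      refine (Finset.abs_sum_le_sum_abs _ _).trans (Finset.sum_le_sum fun l _ => ?_)
      by_cases hl : s l = Pos.basic
      · simp [hdα, hl]
      · have hjl : j ≠ l := by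
          rintro rfl
          exact hl hj
        simp [hdα, hl, comparison, hjl, abs_mul, abs_of_pos (h.pos l)]
    have h4 : f = (fun j => |e j|) - dα := rfl
    rw [mulVec_sub (comparison M), Pi.sub_apply, h.ker, Pi.zero_apply] at h3
    rw [h4, mulVec_sub, Pi.sub_apply]
    rw [h2] at h1
    linarith
  -- Maximum principle: the off-diagonal entries of `A` are nonpositive, so `f⁺ᵀAf⁺ ≤ f⁺ᵀAf ≤ 0`. As
  -- `f⁺` vanishes at the nonbasic index `k`, it vanishes everywhere.
  have hq : (fun j => max (f j) 0) ⬝ᵥ (comparison M *ᵥ fun j => max (f j) 0) ≤ 0 := by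
    have h5 : (fun j => max (f j) 0) ⬝ᵥ (comparison M *ᵥ f) ≤ 0 := by
      refine Finset.sum_nonpos fun j _ => ?_
      by_cases hj : s j = Pos.basic
      · exact mul_nonpos_of_nonneg_of_nonpos (le_max_right _ _) (hAf j hj)
      · simp [hoff j hj]
    refine le_trans ?_ h5
    simp only [dotProduct, mulVec, Finset.mul_sum]
    refine Finset.sum_le_sum fun j _ => Finset.sum_le_sum fun l _ => ?_
    by_cases hjl : j = l
    · subst hjl
      rcases le_total (f j) 0 with hfj | hfj
      · simp [max_eq_right hfj]
      · simp [max_eq_left hfj]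
    · simp only [comparison, of_apply, hjl, if_false]
      refine mul_le_mul_of_nonneg_left ?_ (le_max_right _ _)
      have := mul_le_mul_of_nonneg_left (le_max_left (f l) 0) (abs_nonneg (M j l))
      linarith
  have hzero := congrFun (h.comparison_eq_zero (fun _ => le_max_right _ _) hq (k := k)
    (by simp [hoff k hk])) i
  have hfi : f i ≤ 0 := by
    simpa using hzero
  simpa [hf, he, hdα, hi] using hfi

/-- For `i ∉ α` the entry is `(M(d - b))_i`, with `b` the zero extension of `p̄_α`. Since `|d - b| ≤
d` with equality at `i`, it is at least `(Ad)_i = 0`. -/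
theorem Admissible.bar_nonneg (h : Admissible M d) {s : Status n} (hs : Regular M s)
    (i : Fin n) : 0 ≤ bar M s (M *ᵥ d) i := by
  by_cases hi : s i = Pos.basic
  · rw [bar_of_basic hi]
    have := neg_le_of_abs_le (h.abs_basicSolve_sub_le hs i hi)
    linarith
  · rw [bar_of_ne hi, ← Pi.sub_apply, ← mulVec_sub]
    have := comparison_mulVec_le M (g := d - basicSolve M s (M *ᵥ d)) (h := d) (i := i)
      (fun j => ?_) (by simp [basicSolve_of_ne hi])
    · rwa [h.ker] at this
    · by_cases hj : s j = Pos.basic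
      · rw [Pi.sub_apply, abs_sub_comm]
        exact h.abs_basicSolve_sub_le hs j hj
      · simp [basicSolve_of_ne hj, abs_of_pos (h.pos j)]

end PPPA

namespace PPPA

open Matrix

variable {n : ℕ} {M : Matrix (Fin n) (Fin n) ℝ} {d q p : Fin n → ℝ} {u : Fin n → EReal}

/-! ### Optimality conditions along the parametric path -/

/-- The vector with `γ`-part `u_γ` and with zeros elsewhere. -/
noncomputable def upperPart (u : Fin n → EReal) (s : Status n) : Fin n → ℝ := fun i =>
  if s i = Pos.upper then (u i).toReal else 0

theorem qbar_eq (M : Matrix (Fin n) (Fin n) ℝ) (q : Fin n → ℝ) (u : Fin n → EReal)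
    (s : Status n) : qbar M q u s = bar M s (q + M *ᵥ upperPart u s) := by
  unfold qbar
  congr 1
  funext i
  simp [upperPart, mulVec, dotProduct]

/-- The point with the index triple `s` at the parameter `t`. -/
noncomputable def pathPoint (M : Matrix (Fin n) (Fin n) ℝ) (q p : Fin n → ℝ)
    (u : Fin n → EReal) (s : Status n) (t : ℝ) : Fin n → ℝ :=
  upperPart u s - basicSolve M s (q + M *ᵥ upperPart u s) - t • basicSolve M s p

theorem pathPoint_of_lower {s : Status n} {t : ℝ} {i : Fin n} (hi : s i = Pos.lower) :
    pathPoint M q p u s t i = 0 := by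
  simp [pathPoint, upperPart, basicSolve_of_ne, hi]

theorem pathPoint_of_upper {s : Status n} {t : ℝ} {i : Fin n} (hi : s i = Pos.upper) :
    pathPoint M q p u s t i = (u i).toReal := by
  simp [pathPoint, upperPart, basicSolve_of_ne, hi]

theorem pathPoint_of_basic {s : Status n} {t : ℝ} {i : Fin n} (hi : s i = Pos.basic) :
    pathPoint M q p u s t i = -qbar M q u s i - t * bar M s p i := by
  simp [pathPoint, upperPart, qbar_eq, bar_of_basic, hi]

theorem mulVec_pathPoint (s : Status n) (t : ℝ) (i : Fin n) :
    (M *ᵥ pathPoint M q p u s t) i = (M *ᵥ upperPart u s) i -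
      (M *ᵥ basicSolve M s (q + M *ᵥ upperPart u s)) i - t * (M *ᵥ basicSolve M s p) i := by
  simp [pathPoint, mulVec_sub, mulVec_smul]

theorem gradient_of_basic {s : Status n} (hs : Regular M s) {t : ℝ} {i : Fin n}
    (hi : s i = Pos.basic) : q i + t * p i + (M *ᵥ pathPoint M q p u s t) i = 0 := by
  rw [mulVec_pathPoint, mulVec_basicSolve hs _ hi, mulVec_basicSolve hs _ hi, Pi.add_apply]
  ring

theorem gradient_of_ne {s : Status n} {t : ℝ} {i : Fin n}
    (hi : s i ≠ Pos.basic) : q i + t * p i + (M *ᵥ pathPoint M q p u s t) i =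
      qbar M q u s i + t * bar M s p i := by
  rw [mulVec_pathPoint, qbar_eq, bar_of_ne hi, bar_of_ne hi, Pi.add_apply]
  ring

theorem solution_eq_pathPoint (s : Status n) :
    solution M q u s = pathPoint M q p u s 0 := by
  funext i
  unfold solution
  cases hi : s i
  · exact (pathPoint_of_lower hi).symm
  · simp [pathPoint_of_basic hi]
  · exact (pathPoint_of_upper hi).symm

/-- The optimality conditions at the parameter `t`, with index triple `s`. -/
structure IsKKT (M : Matrix (Fin n) (Fin n) ℝ) (q p : Fin n → ℝ) (u : Fin n → EReal)
    (s : Status n) (t : ℝ) (x : Fin n → ℝ) : Prop where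
  eq_zero : ∀ i, s i = Pos.lower → x i = 0
  eq_upper : ∀ i, s i = Pos.upper → u i < ⊤ ∧ x i = (u i).toReal
  gradient_eq : ∀ i, s i = Pos.basic → q i + t * p i + (M *ᵥ x) i = 0
  gradient_nonneg : ∀ i, s i = Pos.lower → 0 ≤ q i + t * p i + (M *ᵥ x) i
  gradient_nonpos : ∀ i, s i = Pos.upper → q i + t * p i + (M *ᵥ x) i ≤ 0
  mem_box : x ∈ box u

theorem IsKKT.eq_pathPoint {s : Status n} (hs : Regular M s) {t : ℝ} {x : Fin n → ℝ}
    (h : IsKKT M q p u s t x) : x = pathPoint M q p u s t := by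
  rw [← sub_eq_zero]
  refine (regular_iff M s).1 hs _ (fun i hi => ?_) (fun i hi => ?_)
  · cases hsi : s i
    · simp [h.eq_zero i hsi, pathPoint_of_lower hsi]
    · exact absurd hsi hi
    · simp [(h.eq_upper i hsi).2, pathPoint_of_upper hsi]
  · have h1 := h.gradient_eq i hi
    have h2 := gradient_of_basic (q := q) (p := p) (u := u) hs (t := t) hi
    rw [mulVec_sub, Pi.sub_apply]
    linarith

/-- A change of the position of one index at a point where both positions are consistent. -/
theorem IsKKT.update {s : Status n} {t : ℝ} {x : Fin n → ℝ} (h : IsKKT M q p u s t x)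
    (i : Fin n) {v : Pos} (hl : v ≠ Pos.lower)
    (hw : q i + t * p i + (M *ᵥ x) i = 0)
    (hv : v = Pos.upper → u i < ⊤ ∧ x i = (u i).toReal) :
    IsKKT M q p u (Function.update s i v) t x := by
  have key : ∀ j w, Function.update s i v j = w → s j = w ∨ (j = i ∧ v = w) := by
    intro j w hj
    by_cases hji : j = i
    · subst hji
      exact Or.inr ⟨rfl, by simpa using hj⟩
    · exact Or.inl (by rwa [Function.update_of_ne hji] at hj)
  refine ⟨fun j hj => ?_, fun j hj => ?_, fun j hj => ?_, fun j hj => ?_, fun j hj => ?_,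
    h.mem_box⟩ <;> rcases key j _ hj with hj | ⟨rfl, hj'⟩
  exacts [h.eq_zero j hj, absurd hj' hl, h.eq_upper j hj, hv hj', h.gradient_eq j hj, hw,
    h.gradient_nonneg j hj, absurd hj' hl, h.gradient_nonpos j hj, hw.le]

theorem objective_sub (hM : M.IsSymm) (x y : Fin n → ℝ) :
    objective M q y - objective M q x =
      (q + M *ᵥ x) ⬝ᵥ (y - x) + 1 / 2 * ((y - x) ⬝ᵥ (M *ᵥ (y - x))) := by
  have h1 := dotProduct_mulVec_symm hM x y
  have h2 := dotProduct_comm (M *ᵥ x) y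
  have h3 := dotProduct_comm (M *ᵥ x) x
  simp only [objective, mulVec_sub, dotProduct_sub, sub_dotProduct, add_dotProduct]
  linarith

theorem IsKKT.isOptimal (hM : Admissible M d) {s : Status n} {x : Fin n → ℝ}
    (h : IsKKT M q p u s 0 x) : IsOptimal M q u x := by
  refine ⟨h.mem_box, fun y hy => ?_⟩
  rw [← sub_nonneg, objective_sub hM.symm]
  have h1 := hM.quadratic_nonneg (y - x)
  have h2 : 0 ≤ (q + M *ᵥ x) ⬝ᵥ (y - x) := by
    refine Finset.sum_nonneg fun i _ => ?_
    simp only [Pi.add_apply, Pi.sub_apply]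
    cases hi : s i
    · have := h.gradient_nonneg i hi
      rw [h.eq_zero i hi, sub_zero]
      exact mul_nonneg (by linarith) (hy i).1
    · have := h.gradient_eq i hi
      rw [show q i + (M *ᵥ x) i = 0 by linarith, zero_mul]
    · have := h.gradient_nonpos i hi
      obtain ⟨hu, hx⟩ := h.eq_upper i hi
      refine mul_nonneg_of_nonpos_of_nonpos (by linarith) ?_
      have h3 := EReal.toReal_le_toReal (hy i).2 (EReal.coe_ne_bot _) hu.ne
      rw [EReal.toReal_coe] at h3
      linarith
  linarith

/-! ### The invariant of the algorithm, its pivots and its termination -/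

/-- The index triples with the properties that the algorithm maintains. -/
def Reachable (M : Matrix (Fin n) (Fin n) ℝ) (q p : Fin n → ℝ) (u : Fin n → EReal)
    (s : Status n) : Prop :=
  Regular M s ∧ ∃ t x, 0 ≤ t ∧ IsKKT M q p u s t x

theorem reachable_initial (hM : Admissible M d) (hn : 0 < n) (hu : ∀ i, 0 < u i) {τ₀ : ℝ}
    (hτ : 0 < τ₀) (hq : ∀ i, 0 ≤ q i + τ₀ * p i) : Reachable M q p u (initial n) := by
  refine ⟨hM.regular (k := ⟨0, hn⟩) (by simp [initial]), τ₀, 0, hτ.le, ?_⟩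
  constructor <;> simp [initial, hq, box, fun i => (hu i).le]

theorem IsCritical.lower_nonneg {s : Status n} {t : ℝ} (ht : IsCritical M q p u s t) {i : Fin n}
    (hi : s i = Pos.lower) (hp : 0 < bar M s p i) : 0 ≤ qbar M q u s i + t * bar M s p i := by
  have := ht.2 (Or.inl (Or.inr ⟨i, hi, hp, rfl⟩))
  rw [← neg_div, div_le_iff₀ hp] at this
  linarith

theorem IsCritical.basic_le {s : Status n} {t : ℝ} (ht : IsCritical M q p u s t) {i : Fin n}
    (hi : s i = Pos.basic) (hp : 0 < bar M s p i) (hu : u i < ⊤) :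
    -qbar M q u s i - t * bar M s p i ≤ (u i).toReal := by
  have := ht.2 (Or.inr ⟨i, hi, hp, hu, rfl⟩)
  rw [← neg_div, div_le_iff₀ hp] at this
  linarith

/-- Positivity of `b` excludes `⊥`, for which the right side would compare `a` with the default
value `0`. -/
theorem coe_le_iff {a : ℝ} {b : EReal} (hb : 0 < b) : (a : EReal) ≤ b ↔ b < ⊤ → a ≤ b.toReal := by
  induction b with
  | bot => simp at hb
  | coe b => simp
  | top => simp

/-- Feasibility at `t` bounds every ratio by `t`, so `t' ≤ t`. Lower bounds of basic variables and
the gradient signs at `γ` survive because `p̄ ≥ 0`. Upper bounds on `α` and the signs at `β` survive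
by maximality of `t'`; entries with `p̄_i = 0`, which the ratio test skips, do not depend on the
parameter. -/
theorem IsKKT.of_isCritical (hM : Admissible M d) (hu : ∀ i, 0 < u i) {s : Status n}
    (hs : Regular M s) {t t' : ℝ} {x : Fin n → ℝ} (ht : 0 ≤ t)
    (h : IsKKT M q (M *ᵥ d) u s t x) (hc : IsCritical M q (M *ᵥ d) u s t') :
    IsKKT M q (M *ᵥ d) u s t' (pathPoint M q (M *ᵥ d) u s t') := by
  obtain rfl := h.eq_pathPoint hs
  have hp := hM.bar_nonneg hs
  have hw : ∀ i, s i = Pos.lower → 0 ≤ qbar M q u s i + t * bar M s (M *ᵥ d) i := fun i hi => by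
    rw [← gradient_of_ne (by simp [hi])]
    exact h.gradient_nonneg i hi
  have hx : ∀ i, s i = Pos.basic → 0 ≤ -qbar M q u s i - t * bar M s (M *ᵥ d) i ∧
      (u i < ⊤ → -qbar M q u s i - t * bar M s (M *ᵥ d) i ≤ (u i).toReal) := fun i hi => by
    rw [← coe_le_iff (hu i), ← pathPoint_of_basic hi]
    exact h.mem_box i
  have htt : t' ≤ t := by
    rcases hc.1 with (h0 | ⟨i, hi, hpi, h1⟩) | ⟨i, hi, hpi, hui, h1⟩
    · rw [h0]
      exact ht
    · rw [h1, ← neg_div, div_le_iff₀ hpi]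
      linarith [hw i hi]
    · rw [h1, ← neg_div, div_le_iff₀ hpi]
      linarith [(hx i hi).2 hui]
  have hmono : ∀ i, t' * bar M s (M *ᵥ d) i ≤ t * bar M s (M *ᵥ d) i := fun i =>
    mul_le_mul_of_nonneg_right htt (hp i)
  refine ⟨fun i hi => pathPoint_of_lower hi,
    fun i hi => ⟨(h.eq_upper i hi).1, pathPoint_of_upper hi⟩,
    fun i hi => gradient_of_basic hs hi, fun i hi => ?_, fun i hi => ?_, fun i => ?_⟩
  · rw [gradient_of_ne (by simp [hi])]
    rcases (hp i).lt_or_eq with hpi | hpi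
    · exact hc.lower_nonneg hi hpi
    · have := hw i hi
      rw [← hpi] at this ⊢
      simpa using this
  · have := h.gradient_nonpos i hi
    rw [gradient_of_ne (by simp [hi])] at this ⊢
    linarith [hmono i]
  · rw [coe_le_iff (hu i)]
    cases hi : s i
    · rw [pathPoint_of_lower hi]
      exact ⟨le_rfl, fun h => EReal.toReal_nonneg (hu i).le⟩
    · rw [pathPoint_of_basic hi]
      refine ⟨by linarith [hmono i, (hx i hi).1], fun hui => ?_⟩
      rcases (hp i).lt_or_eq with hpi | hpi
      · exact hc.basic_le hi hpi hui
      · have := (hx i hi).2 hui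
        rw [← hpi] at this ⊢
        simpa using this
    · rw [pathPoint_of_upper hi]
      exact ⟨EReal.toReal_nonneg (hu i).le, fun _ => le_rfl⟩

/-- The other three kinds need a vanishing Schur complement entry at an index with `p̄_i > 0`. -/
theorem Pivot.kind_eq (hM : Admissible M d) {s s' : Status n} (hs : Regular M s) {κ : Kind}
    (h : Pivot M q (M *ᵥ d) u κ s s') : κ = Kind.toUpper ∨ κ = Kind.enter := by
  cases h with
  | toUpper => exact Or.inl rfl
  | enter => exact Or.inr rfl
  | jump _ t i hc ht hr h0 => exact absurd h0 (hM.schurDiag_pos hs (by simp [hr.1]) hr.2.1).ne'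
  | swapDown _ t i j r hc ht hr h0 =>
    exact absurd h0 (hM.schurDiag_pos hs (by simp [hr.1]) hr.2.1).ne'
  | swapUp _ t i j r hc ht hr h0 =>
    exact absurd h0 (hM.schurDiag_pos hs (by simp [hr.1]) hr.2.1).ne'

theorem Admissible.not_stopsUnbounded (hM : Admissible M d) {s : Status n} (hs : Regular M s) :
    ¬ StopsUnbounded M q (M *ᵥ d) u s := by
  rintro ⟨t, i, -, -, hr, h0, -⟩
  exact absurd h0 (hM.schurDiag_pos hs (by simp [hr.1]) hr.2.1).ne'

/-- The sum of the codes `0, 1, 2` is the potential that counts pivots: moves `β → α` and `α → γ`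
both raise it by one. -/
theorem sum_code_update {s : Status n} {i : Fin n} {v : Pos} (h : v.code = (s i).code + 1) :
    ∑ j, (Function.update s i v j).code = ∑ j, (s j).code + 1 := by
  rw [← Finset.add_sum_erase _ _ (Finset.mem_univ i),
    ← Finset.add_sum_erase _ (fun j => (s j).code) (Finset.mem_univ i), Function.update_self, h,
    Finset.sum_congr rfl fun j hj => by rw [Function.update_of_ne (Finset.ne_of_mem_erase hj)]]
  ring

/-- A pivot preserves the invariants of the algorithm and moves one index upwards. -/
theorem Reachable.pivot (hM : Admissible M d) (hu : ∀ i, 0 < u i) {s s' : Status n}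
    (hs : Reachable M q (M *ᵥ d) u s) {κ : Kind} (h : Pivot M q (M *ᵥ d) u κ s s') :
    Reachable M q (M *ᵥ d) u s' ∧ ∑ j, (s' j).code = ∑ j, (s j).code + 1 := by
  obtain ⟨hreg, t₀, x₀, ht₀, hx₀⟩ := hs
  have hκ := h.kind_eq hM hreg
  cases h with
  | toUpper _ t i hc ht hr =>
    obtain ⟨hi, hp, hui, hrt⟩ := hr
    have hk := hx₀.of_isCritical hM hu hreg ht₀ hc
    refine ⟨⟨hM.regular (k := i) (by simp), t, pathPoint M q (M *ᵥ d) u s t, ht.le, ?_⟩,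
      sum_code_update (by simp [hi, Pos.code])⟩
    have hxi : pathPoint M q (M *ᵥ d) u s t i = (u i).toReal := by
      rw [pathPoint_of_basic hi, hrt]
      field_simp
      ring
    exact hk.update i (by simp) (hk.gradient_eq i hi) fun _ => ⟨hui, hxi⟩
  | enter _ t i hc ht hr hσ =>
    obtain ⟨hi, hp, hrt⟩ := hr
    have hk := hx₀.of_isCritical hM hu hreg ht₀ hc
    -- Entering may turn `α` into `[n]`, where `Admissible.regular` does not apply; the positive
    -- Schur complement entry takes its place.
    refine ⟨⟨hreg.update_basic (by simp [hi]) hσ.ne', t, pathPoint M q (M *ᵥ d) u s t,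
      ht.le, ?_⟩,
      sum_code_update (by simp [hi, Pos.code])⟩
    have hwi : q i + t * (M *ᵥ d) i + (M *ᵥ pathPoint M q (M *ᵥ d) u s t) i = 0 := by
      rw [gradient_of_ne (by simp [hi]), hrt]
      field_simp
      ring
    exact hk.update i (by simp) hwi (by simp)
  | _ => simp at hκ

theorem IsRun.reachable (hM : Admissible M d) (hn : 0 < n) (hu : ∀ i, 0 < u i) {τ₀ : ℝ}
    (hτ : 0 < τ₀) (hq : ∀ i, 0 ≤ q i + τ₀ * (M *ᵥ d) i) {N : ℕ} {σ : ℕ → Status n}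
    (h : IsRun M q (M *ᵥ d) u N σ) : ∀ k ≤ N,
      Reachable M q (M *ᵥ d) u (σ k) ∧ ∑ j, (σ k j).code = k := by
  intro k
  induction k with
  | zero =>
    intro _
    rw [h.1]
    exact ⟨reachable_initial hM hn hu hτ hq, by simp [initial, Pos.code]⟩
  | succ k ih =>
    intro hk
    obtain ⟨hr, hc⟩ := ih (by omega)
    obtain ⟨κ, hκ⟩ := h.2 k (by omega)
    obtain ⟨hr', hc'⟩ := hr.pivot hM hu hκ
    exact ⟨hr', by rw [hc', hc]⟩

theorem sum_code_le (s : Status n) : ∑ j, (s j).code ≤ 2 * n := by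
  refine (Finset.sum_le_card_nsmul _ _ 2 fun j _ => ?_).trans (by simp [mul_comm])
  cases s j <;> simp [Pos.code]

theorem exists_isCritical (M : Matrix (Fin n) (Fin n) ℝ) (q p : Fin n → ℝ) (u : Fin n → EReal)
    (s : Status n) : ∃ t, IsCritical M q p u s t := by
  have hfin : Set.Finite ({0} ∪ {r | ∃ i, LowerRatio M q p u s i r} ∪
      {r | ∃ i, UpperRatio M q p u s i r}) := by
    refine ((Set.finite_singleton _).union ?_).union ?_
    · refine (Set.finite_range fun i => -(qbar M q u s i / bar M s p i)).subset ?_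
      rintro r ⟨i, hi⟩
      exact ⟨i, hi.2.2.symm⟩
    · refine (Set.finite_range fun i => -(((u i).toReal + qbar M q u s i) / bar M s p i)).subset ?_
      rintro r ⟨i, hi⟩
      exact ⟨i, hi.2.2.2.symm⟩
  obtain ⟨t, ht⟩ := hfin.exists_maximal ⟨0, by simp⟩
  exact ⟨t, ht.1, fun r hr => (le_total r t).elim id fun h => ht.2 hr h⟩

/-- A nonzero critical value leads to a diagonal pivot. -/
theorem Admissible.stops_or_pivot (hM : Admissible M d) {s : Status n} (hs : Regular M s) :
    StopsOptimal M q (M *ᵥ d) u s ∨ ∃ κ s', Pivot M q (M *ᵥ d) u κ s s' := by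
  obtain ⟨t, ht⟩ := exists_isCritical M q (M *ᵥ d) u s
  rcases (ht.2 (Or.inl (Or.inl rfl)) : (0 : ℝ) ≤ t).lt_or_eq with h | h
  · right
    rcases ht.1 with (h0 | ⟨i, hi⟩) | ⟨i, hi⟩
    · exact absurd h0 h.ne'
    · exact ⟨_, _, .enter s t i ht h hi (hM.schurDiag_pos hs (by simp [hi.1]) hi.2.1)⟩
    · exact ⟨_, _, .toUpper s t i ht h hi⟩
  · left
    rw [StopsOptimal, h]
    exact ht

theorem Reachable.isOptimal (hM : Admissible M d) (hu : ∀ i, 0 < u i) {s : Status n}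
    (hs : Reachable M q (M *ᵥ d) u s) (h : StopsOptimal M q (M *ᵥ d) u s) :
    IsOptimal M q u (solution M q u s) := by
  obtain ⟨hreg, t, x, ht, hx⟩ := hs
  rw [solution_eq_pathPoint (p := M *ᵥ d)]
  exact (hx.of_isCritical hM hu hreg ht h).isOptimal hM

end PPPA

namespace PPPA

/-! ### Running times -/

/-- A sum of constants and of copies of register `0`. -/
def NExp.IsSize : NExp → Prop
  | .const _ => True
  | .reg v => v = 0
  | .add e f => e.IsSize ∧ f.IsSize
  | _ => False

/-- A factor `c` such that the value is at most `c * n`, for expressions with `IsSize`. -/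
def NExp.factor : NExp → ℕ
  | .const k => k
  | .reg _ => 1
  | .add e f => e.factor + f.factor
  | _ => 0

theorem NExp.IsSize.eval_le {e : NExp} (he : e.IsSize) {m : Mem} (hm : 1 ≤ m.reg 0) :
    e.eval m ≤ e.factor * m.reg 0 := by
  induction e with
  | const k => exact Nat.le_mul_of_pos_right k hm
  | reg v =>
    obtain rfl : v = 0 := he
    simp [eval, factor]
  | add e f ihe ihf =>
    have := ihe he.1
    have := ihf he.2
    simp only [eval, factor, add_mul]
    omega
  | get => exact he.elim
  | sub => exact he.elim

/-- The program does not change register `0`, and its loops have lengths of order `n`. -/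
def Prog.IsPoly : Prog → Prop
  | .skip => True
  | .setReg v _ => v ≠ 0
  | .setNat _ _ _ _ => True
  | .setReal _ _ _ _ => True
  | .seq c d => c.IsPoly ∧ d.IsPoly
  | .ite _ c d => c.IsPoly ∧ d.IsPoly
  | .loop v e c => v ≠ 0 ∧ e.IsSize ∧ c.IsPoly

/-- The depth of nested loops. -/
def Prog.degree : Prog → ℕ
  | .seq c d => max c.degree d.degree
  | .ite _ c d => max c.degree d.degree
  | .loop _ _ c => c.degree + 1
  | _ => 0

/-- The leading coefficient of a bound for the running time. -/
def Prog.coef : Prog → ℕ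
  | .skip => 1
  | .setReg _ e => e.cost + 1
  | .setNat _ i j e => i.cost + j.cost + e.cost + 1
  | .setReal _ i j e => i.cost + j.cost + e.cost + 1
  | .seq c d => c.coef + d.coef
  | .ite b c d => b.cost + (c.coef + d.coef) + 1
  | .loop _ e c => e.cost + 1 + e.factor * (c.coef + 1)

theorem iterate_induction {f : ℕ → Mem → Mem} (I : ℕ → Mem → Prop) {N : ℕ} {m : Mem}
    (h0 : I 0 m) (hs : ∀ k < N, ∀ m', I k m' → I (k + 1) (f k m')) : I N (iterate f N m) := by
  induction N with
  | zero => exact h0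
  | succ N ih => exact hs N (by omega) _ (ih fun k hk => hs k (by omega))

theorem Mem.setReg_reg_of_ne (m : Mem) {v w : ℕ} (k : ℕ) (h : w ≠ v) :
    (m.setReg v k).reg w = m.reg w := by
  simp [Mem.setReg, h]

theorem Prog.IsPoly.exec_reg_zero {c : Prog} (hc : c.IsPoly) (m : Mem) :
    (c.exec m).reg 0 = m.reg 0 := by
  induction c generalizing m with
  | skip => rfl
  | setReg v e => exact Mem.setReg_reg_of_ne m _ (Ne.symm hc)
  | setNat => rfl
  | setReal => rfl
  | seq c d ihc ihd => exact (ihd hc.2 _).trans (ihc hc.1 _)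
  | ite b c d ihc ihd =>
    rw [exec]
    split_ifs
    exacts [ihc hc.1 _, ihd hc.2 _]
  | loop v e c ih =>
    rw [exec]
    refine iterate_induction (fun _ m' => m'.reg 0 = m.reg 0) rfl fun k _ m' hm' => ?_
    rw [ih hc.2.2, Mem.setReg_reg_of_ne _ _ (Ne.symm hc.1), hm']

/-- Register `0` keeps the value `n`, so each loop runs at most `factor * n` times and each level of
nesting costs one power of `n`. Using `n ≥ 1`, constant lengths and lower powers are absorbed. -/
theorem Prog.IsPoly.cost_le {c : Prog} (hc : c.IsPoly) {n : ℕ} (hn : 1 ≤ n) {m : Mem}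
    (hm : m.reg 0 = n) : c.cost m ≤ c.coef * n ^ c.degree := by
  induction c generalizing m with
  | skip => simp [cost, coef, degree]
  | setReg v e => simp [cost, coef, degree]
  | setNat => simp [cost, coef, degree]
  | setReal => simp [cost, coef, degree]
  | seq c d ihc ihd =>
    have h1 := ihc hc.1 hm
    have h2 := ihd hc.2 ((hc.1.exec_reg_zero m).trans hm)
    rw [cost, coef, degree, add_mul]
    exact add_le_add
      (h1.trans (Nat.mul_le_mul_left _ (Nat.pow_le_pow_right hn (le_max_left _ _))))
      (h2.trans (Nat.mul_le_mul_left _ (Nat.pow_le_pow_right hn (le_max_right _ _))))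
  | ite b c d ihc ihd =>
    have h1 := (ihc hc.1 hm).trans
      (Nat.mul_le_mul_left _ (Nat.pow_le_pow_right hn (le_max_left c.degree d.degree)))
    have h2 := (ihd hc.2 hm).trans
      (Nat.mul_le_mul_left _ (Nat.pow_le_pow_right hn (le_max_right c.degree d.degree)))
    have h3 : 1 ≤ n ^ max c.degree d.degree := Nat.one_le_pow _ _ hn
    rw [cost, coef, degree]
    have h4 : b.cost ≤ b.cost * n ^ max c.degree d.degree := Nat.le_mul_of_pos_right _ h3
    simp only [add_mul]
    split_ifs <;> omega
  | loop v e c ih =>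
    have hreg : ∀ k, (iterate (fun k' m' => c.exec (m'.setReg v k')) k m).reg 0 = n := fun k =>
      iterate_induction (fun _ m' => m'.reg 0 = n) hm fun k _ m' hm' => by
        rw [hc.2.2.exec_reg_zero, Mem.setReg_reg_of_ne _ _ (Ne.symm hc.1), hm']
    have h1 : ∀ k ∈ Finset.range (e.eval m),
        c.cost ((iterate (fun k' m' => c.exec (m'.setReg v k')) k m).setReg v k) + 1 ≤
          (c.coef + 1) * n ^ c.degree := by
      intro k _
      have h2 := ih hc.2.2 (m := (iterate (fun k' m' => c.exec (m'.setReg v k')) k m).setReg v k)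
        (by rw [Mem.setReg_reg_of_ne _ _ (Ne.symm hc.1), hreg])
      have h3 : 1 ≤ n ^ c.degree := Nat.one_le_pow _ _ hn
      rw [add_mul]
      omega
    have h4 := Finset.sum_le_card_nsmul _ _ _ h1
    have h5 := hc.2.1.eval_le (m := m) (by omega)
    rw [hm] at h5
    rw [Finset.card_range, smul_eq_mul] at h4
    rw [cost, coef, degree, add_mul]
    refine add_le_add (Nat.le_mul_of_pos_right _ (Nat.one_le_pow _ _ hn))
      (h4.trans ((Nat.mul_le_mul_right _ h5).trans (le_of_eq ?_)))
    ring

/-! ### Loops that fill an array -/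

/-- `m'` differs from `m` at most in the real array `a` and in the registers `3` and `4`. -/
structure Frame (a : ℕ) (m m' : Mem) : Prop where
  nat : m'.nat = m.nat
  real : ∀ b, b ≠ a → m'.real b = m.real b
  reg : ∀ v, v ≠ 3 → v ≠ 4 → m'.reg v = m.reg v

theorem Frame.refl (a : ℕ) (m : Mem) : Frame a m m := ⟨rfl, fun _ _ => rfl, fun _ _ _ => rfl⟩

theorem Frame.setReg {a : ℕ} {m m' : Mem} (h : Frame a m m') {v : ℕ} (hv : v = 3 ∨ v = 4)
    (k : ℕ) : Frame a m (m'.setReg v k) :=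
  ⟨h.nat, h.real, fun w h3 h4 => by
    rw [Mem.setReg_reg_of_ne _ _ (by omega), h.reg w h3 h4]⟩

theorem Frame.setReal {a : ℕ} {m m' : Mem} (h : Frame a m m') (i j : ℕ) (x : ℝ) :
    Frame a m (m'.setReal a i j x) :=
  ⟨h.nat, fun b hb => by simp [Mem.setReal, hb, h.real b hb], h.reg⟩

/-- The values `g` are fixed in advance while array `a` changes, so the loop body must compute them
without depending on what has already been written to `a`. -/
theorem exec_fill {c : Prog} {e f : NExp} {a K : ℕ} {m : Mem} {g : ℕ → ℕ → ℝ}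
    (hf : ∀ m', Frame a m m' → f.eval m' = K)
    (hc : ∀ m', Frame a m m' →
      c.exec m' = m'.setReal a (m'.reg 3) (m'.reg 4) (g (m'.reg 3) (m'.reg 4))) :
    Frame a m ((Prog.loop 3 e (.loop 4 f c)).exec m) ∧
      ((Prog.loop 3 e (.loop 4 f c)).exec m).real a =
        fun i j => if i < e.eval m ∧ j < K then g i j else m.real a i j := by
  rw [Prog.exec]
  refine iterate_induction (fun k m' => Frame a m m' ∧
    m'.real a = fun i j => if i < k ∧ j < K then g i j else m.real a i j)
    ⟨Frame.refl a m, by simp⟩ ?_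
  rintro k - m' ⟨hF, hr⟩
  rw [Prog.exec, hf _ (hF.setReg (Or.inl rfl) k)]
  have := iterate_induction (N := K) (f := fun k m' => c.exec (m'.setReg 4 k))
    (m := m'.setReg 3 k) (fun l m' => Frame a m m' ∧ m'.reg 3 = k ∧
    m'.real a = fun i j => if (i < k ∧ j < K) ∨ (i = k ∧ j < l) then g i j else m.real a i j)
    ⟨hF.setReg (Or.inl rfl) k, by simp [Mem.setReg], by simp [Mem.setReg, hr]⟩ ?_
  · refine ⟨this.1, this.2.2.trans ?_⟩
    funext i j
    congr 1
    simp only [eq_iff_iff]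
    omega
  · rintro l hl m'' ⟨hF', hk, hr'⟩
    have hF4 := hF'.setReg (v := 4) (Or.inr rfl) l
    have h3 : (m''.setReg 4 l).reg 3 = k := by simp [Mem.setReg, hk]
    have h4 : (m''.setReg 4 l).reg 4 = l := by simp [Mem.setReg]
    simp only [hc _ hF4, h3, h4]
    refine ⟨hF4.setReal _ _ _, h3, ?_⟩
    have hra : (m''.setReg 4 l).real a = m''.real a := rfl
    simp only [Mem.setReal, Function.update_self, hra, hr']
    funext i j
    by_cases hi : i = k
    · subst hi
      by_cases hj : j = l
      · subst hj
        simp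
      · have : j < l + 1 ↔ j < l := by omega
        simp [hj, this]
    · simp [hi]

end PPPA

namespace PPPA

open Matrix

variable {n : ℕ} {M : Matrix (Fin n) (Fin n) ℝ} {d q p : Fin n → ℝ} {u : Fin n → EReal}

/-! ### Tableaus -/

/-- The dependent variables at the index triple `s`, for `w = a q + b p + M x`: the entries of
`x` in the basic positions and the entries of `w` in the other ones. -/
noncomputable def rowVar (M : Matrix (Fin n) (Fin n) ℝ) (q p : Fin n → ℝ) (s : Status n)
    (a b : ℝ) (x : Fin n → ℝ) : Fin n → ℝ := fun i =>
  if s i = Pos.basic then x i else a * q i + b * p i + (M *ᵥ x) i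

/-- The independent variables at the index triple `s`: the entries of `w = a q + b p + M x` in
the basic positions and the distances of `x` from its bounds in the other ones. -/
noncomputable def colVar (M : Matrix (Fin n) (Fin n) ℝ) (q p : Fin n → ℝ) (u : Fin n → EReal)
    (s : Status n) (a b : ℝ) (x : Fin n → ℝ) : Fin n → ℝ := fun i =>
  match s i with
  | Pos.basic => a * q i + b * p i + (M *ᵥ x) i
  | Pos.lower => x i
  | Pos.upper => x i - a * (u i).toReal

/-- The sequence `z₀, …, z_{n-1}, a, b, b, …`. -/
noncomputable def extend (z : Fin n → ℝ) (a b : ℝ) : ℕ → ℝ := fun k =>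
  if h : k < n then z ⟨k, h⟩ else if k = n then a else b

/-- `A` expresses the dependent variables by the independent ones; its columns `n` and `n + 1`
hold the coefficients of `a` and `b`. -/
def IsTableau (M : Matrix (Fin n) (Fin n) ℝ) (q p : Fin n → ℝ) (u : Fin n → EReal)
    (s : Status n) (A : ℕ → ℕ → ℝ) : Prop :=
  ∀ (a b : ℝ) (x : Fin n → ℝ) (i : Fin n), rowVar M q p s a b x i =
    ∑ k ∈ Finset.range (n + 2), A i k * extend (colVar M q p u s a b x) a b k

theorem sum_mul_extend (c : ℕ → ℝ) (z : Fin n → ℝ) (a b : ℝ) :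
    ∑ k ∈ Finset.range (n + 2), c k * extend z a b k =
      ∑ i : Fin n, c i * z i + c n * a + c (n + 1) * b := by
  rw [Finset.sum_range_succ, Finset.sum_range_succ, Finset.sum_range]
  simp [extend]

theorem IsTableau.congr {s : Status n} {A B : ℕ → ℕ → ℝ} (h : IsTableau M q p u s A)
    (hAB : ∀ i < n, ∀ k < n + 2, B i k = A i k) : IsTableau M q p u s B := by
  intro a b x i
  rw [h a b x i]
  exact Finset.sum_congr rfl fun k hk => by rw [hAB i i.2 k (Finset.mem_range.1 hk)]

theorem IsTableau.initial {A : ℕ → ℕ → ℝ} (hM : ∀ i j : Fin n, A i j = M i j)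
    (hq : ∀ i : Fin n, A i n = q i) (hp : ∀ i : Fin n, A i (n + 1) = p i) :
    IsTableau M q p u (initial n) A := by
  intro a b x i
  rw [sum_mul_extend, hq, hp]
  simp only [rowVar, colVar, PPPA.initial, hM, mulVec, dotProduct]
  simp only [reduceCtorEq, if_false]
  ring

/-- Columns are identified by inserting test points into the identity. At `a = 1`, `b = 0` and the
path point for `t = 0`, all independent variables vanish and only column `n` remains. The sign
change on basic rows arises because `x_α = -q̄_α`. -/
theorem IsTableau.column_q {s : Status n} {A : ℕ → ℕ → ℝ} (h : IsTableau M q p u s A)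
    (hs : Regular M s) (i : Fin n) :
    A i n = if s i = Pos.basic then -qbar M q u s i else qbar M q u s i := by
  have hz : colVar M q p u s 1 0 (pathPoint M q p u s 0) = 0 := by
    funext j
    unfold colVar
    cases hj : s j
    · simp [pathPoint_of_lower hj]
    · simpa using gradient_of_basic (q := q) (p := p) (u := u) hs (t := 0) hj
    · simp [pathPoint_of_upper hj]
  have h1 := h 1 0 (pathPoint M q p u s 0) i
  rw [sum_mul_extend, hz] at h1
  simp only [Pi.zero_apply, mul_zero, Finset.sum_const_zero, zero_add, mul_one, add_zero] at h1
  rw [← h1, rowVar]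
  split_ifs with hi
  · simp [pathPoint_of_basic hi]
  · simpa using gradient_of_ne (q := q) (p := p) (u := u) (t := 0) hi

theorem IsTableau.column_p {s : Status n} {A : ℕ → ℕ → ℝ} (h : IsTableau M q p u s A)
    (hs : Regular M s) (i : Fin n) :
    A i (n + 1) = if s i = Pos.basic then -bar M s p i else bar M s p i := by
  have hz : colVar M q p u s 0 1 (-basicSolve M s p) = 0 := by
    funext j
    unfold colVar
    cases hj : s j
    · simp [basicSolve_of_ne, hj]
    · simp [mulVec_neg, mulVec_basicSolve hs p hj]
    · simp [basicSolve_of_ne, hj]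
  have h1 := h 0 1 (-basicSolve M s p) i
  rw [sum_mul_extend, hz] at h1
  simp only [Pi.zero_apply, mul_zero, Finset.sum_const_zero, zero_add, mul_one] at h1
  rw [← h1, rowVar]
  split_ifs with hi
  · simp [bar_of_basic hi]
  · simp [bar_of_ne hi, mulVec_neg, sub_eq_add_neg]

theorem IsTableau.column_of_colVar {s : Status n} {A : ℕ → ℕ → ℝ} (h : IsTableau M q p u s A)
    {i : Fin n} {x : Fin n → ℝ} (hz : colVar M q p u s 0 0 x = Pi.single i 1) (j : Fin n) :
    A j i = rowVar M q p s 0 0 x j := by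
  rw [h 0 0 x j, sum_mul_extend, hz]
  simp [Pi.single_apply]

/-- The test point `e_i - m̂` makes the `i`-th independent variable `1` and all others `0`. -/
theorem IsTableau.diag_of_lower {s : Status n} {A : ℕ → ℕ → ℝ} (h : IsTableau M q p u s A)
    (hs : Regular M s) {i : Fin n} (hi : s i = Pos.lower) : A i i = schurDiag M s i := by
  have hz : colVar M q p u s 0 0 (Pi.single i 1 - mhat M s i) = Pi.single i 1 := by
    funext j
    unfold colVar
    have hne : s j = Pos.basic ∨ s j = Pos.upper → j ≠ i := by
      rintro h rfl
      simp [hi] at h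
    cases hj : s j
    · simp [mhat, basicSolve_of_ne, hj]
    · simp [mulVec_single_sub_mhat hs hj, hne (Or.inl hj)]
    · simp [mhat, basicSolve_of_ne, hj]
  rw [h.column_of_colVar hz, schurDiag_eq]
  simp [rowVar, hi]

/-- The entry is `x_i` for `x = M_αα⁻¹ e_i`, extended by zeros. If it vanished, then `xᵀMx = x_i =
0`, hence `Mx = 0`, against `(Mx)_i = 1`. Only semidefiniteness and regularity enter, so `α = [n]`
is allowed. -/
theorem IsTableau.diag_of_basic (hM : Admissible M d) {s : Status n} {A : ℕ → ℕ → ℝ}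
    (h : IsTableau M q p u s A) (hs : Regular M s) {i : Fin n} (hi : s i = Pos.basic) :
    A i i ≠ 0 := by
  have hMx : ∀ j, s j = Pos.basic →
      (M *ᵥ basicSolve M s (Pi.single i 1)) j = (Pi.single i 1 : Fin n → ℝ) j :=
    fun j hj => mulVec_basicSolve hs _ hj
  have hz : colVar M q p u s 0 0 (basicSolve M s (Pi.single i 1)) = Pi.single i 1 := by
    funext j
    unfold colVar
    have hne : s j ≠ Pos.basic → j ≠ i := by
      rintro h rfl
      exact h hi
    cases hj : s j
    · simp [basicSolve_of_ne, hj, hne]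
    · simp [hMx j hj]
    · simp [basicSolve_of_ne, hj, hne]
  rw [h.column_of_colVar hz]
  simp only [rowVar, hi, if_true]
  intro h0
  have h1 : M *ᵥ basicSolve M s (Pi.single i 1) = 0 := by
    refine hM.mulVec_eq_zero (Finset.sum_eq_zero fun j _ => ?_)
    by_cases hj : s j = Pos.basic
    · rw [hMx j hj]
      by_cases hji : j = i
      · rw [hji, h0, zero_mul]
      · simp [hji]
    · rw [basicSolve_of_ne hj, zero_mul]
  have h2 := hMx i hi
  rw [h1] at h2
  simp at h2

/-! ### Exchange steps on tableaus -/

/-- The principal pivot on the entry `(r, r)`. -/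
noncomputable def principalPivot (A : ℕ → ℕ → ℝ) (r : ℕ) : ℕ → ℕ → ℝ := fun j k =>
  -- The form `0 - …` is the one that `pivotEntry` computes, since `RExp` has no negation.
  if j = r then (if k = r then 1 / A r r else 0 - A r k / A r r)
  else (if k = r then A j r / A r r else A j k - A j r * A r k / A r r)

/-- Addition of `v` times column `r` to column `c`. -/
noncomputable def addColumn (A : ℕ → ℕ → ℝ) (r c : ℕ) (v : ℝ) : ℕ → ℕ → ℝ := fun j k =>
  if k = c then A j k + A j r * v else A j k

/-- Row `r`, solved for `z_r`, is substituted into the other rows; afterwards `z_r` is dependent and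
the old row value is independent. -/
theorem sum_principalPivot {S : Finset ℕ} {A : ℕ → ℕ → ℝ} {r : ℕ} (hr : r ∈ S)
    (hA : A r r ≠ 0) (z : ℕ → ℝ) (j : ℕ) :
    ∑ k ∈ S, principalPivot A r j k * Function.update z r (∑ k ∈ S, A r k * z k) k =
      if j = r then z r else ∑ k ∈ S, A j k * z k := by
  rw [← Finset.add_sum_erase S (fun k => A r k * z k) hr,
    ← Finset.add_sum_erase S (fun k => A j k * z k) hr, ← Finset.add_sum_erase S _ hr,
    Function.update_self]
  have hcongr : ∀ y, ∑ k ∈ S.erase r, principalPivot A r j k * Function.update z r y k =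
      ∑ k ∈ S.erase r, (if j = r then 0 - A r k / A r r else A j k - A j r * A r k / A r r) *
        z k := by
    refine fun y => Finset.sum_congr rfl fun k hk => ?_
    have hkr := Finset.ne_of_mem_erase hk
    simp [principalPivot, hkr]
  rw [hcongr]
  by_cases hj : j = r
  · have : ∑ k ∈ S.erase r, (0 - A r k / A r r) * z k =
        -(1 / A r r) * ∑ k ∈ S.erase r, A r k * z k := by
      rw [Finset.mul_sum]
      exact Finset.sum_congr rfl fun k _ => by ring
    simp only [hj, principalPivot, if_true, this]
    field_simp
    ring
  · have : ∑ k ∈ S.erase r, (A j k - A j r * A r k / A r r) * z k =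
        ∑ k ∈ S.erase r, A j k * z k - A j r / A r r * ∑ k ∈ S.erase r, A r k * z k := by
      rw [Finset.mul_sum, ← Finset.sum_sub_distrib]
      exact Finset.sum_congr rfl fun k _ => by ring
    simp only [hj, principalPivot, if_true, if_false, this]
    field_simp
    ring

theorem sum_addColumn {S : Finset ℕ} {A : ℕ → ℕ → ℝ} {r c : ℕ} (hr : r ∈ S) (hc : c ∈ S)
    (hrc : r ≠ c) (v : ℝ) (z : ℕ → ℝ) (j : ℕ) :
    ∑ k ∈ S, addColumn A r c v j k * Function.update z r (z r - z c * v) k =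
      ∑ k ∈ S, A j k * z k := by
  have h1 : ∀ k ∈ S, addColumn A r c v j k * Function.update z r (z r - z c * v) k =
      A j k * z k + (if k = c then A j r * v * z c else 0) -
        (if k = r then A j r * z c * v else 0) := by
    intro k _
    by_cases hkr : k = r
    · subst hkr
      simp [addColumn, hrc]
      ring
    · by_cases hkc : k = c
      · subst hkc
        simp [addColumn, hkr]
        ring
      · simp [addColumn, hkr, hkc]
  rw [Finset.sum_congr rfl h1, Finset.sum_sub_distrib, Finset.sum_add_distrib,
    Finset.sum_ite_eq' S c, Finset.sum_ite_eq' S r]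
  simp [hr, hc]
  ring

theorem extend_update (z : Fin n → ℝ) (a b y : ℝ) (i : Fin n) :
    extend (Function.update z i y) a b = Function.update (extend z a b) i y := by
  funext k
  by_cases hk : k = i
  · subst hk
    simp [extend]
  · rw [Function.update_of_ne hk]
    unfold extend
    split_ifs with h
    · rw [Function.update_of_ne]
      rintro rfl
      exact hk rfl
    · rfl
    · rfl

theorem IsTableau.enter {s : Status n} {A : ℕ → ℕ → ℝ} (h : IsTableau M q p u s A) {i : Fin n}
    (hi : s i = Pos.lower) (hA : A i i ≠ 0) :
    IsTableau M q p u (Function.update s i Pos.basic) (principalPivot A i) := by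
  intro a b x j
  have hz : colVar M q p u (Function.update s i Pos.basic) a b x =
      Function.update (colVar M q p u s a b x) i (rowVar M q p s a b x i) := by
    funext k
    by_cases hk : k = i
    · subst hk
      simp [colVar, rowVar, hi]
    · simp [colVar, hk]
  rw [hz, extend_update, h a b x i,
    sum_principalPivot (Finset.mem_range.2 (by omega)) hA]
  by_cases hj : j = i
  · subst hj
    simp [rowVar, extend, colVar, hi]
  · rw [if_neg (by omega), ← h a b x j]
    simp [rowVar, hj]

/-- After the exchange the independent variable is `x_i`, whereas a nonbasic index at its upper
bound carries `x_i - a u_i`. The difference `a u_i` is absorbed by adding `u_i` times column `i` to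
the column of `a`. -/
theorem IsTableau.toUpper {s : Status n} {A : ℕ → ℕ → ℝ} (h : IsTableau M q p u s A) {i : Fin n}
    (hi : s i = Pos.basic) (hA : A i i ≠ 0) :
    IsTableau M q p u (Function.update s i Pos.upper)
      (addColumn (principalPivot A i) i n (u i).toReal) := by
  intro a b x j
  set z := extend (colVar M q p u s a b x) a b with hz
  have hz1 : extend (colVar M q p u (Function.update s i Pos.upper) a b x) a b =
      Function.update (Function.update z i (rowVar M q p s a b x i)) i
        (Function.update z i (rowVar M q p s a b x i) i -
          Function.update z i (rowVar M q p s a b x i) n * (u i).toReal) := by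
    rw [Function.update_idem, hz, ← extend_update]
    congr 1
    funext k
    by_cases hk : k = i
    · subst hk
      have : n ≠ (k : ℕ) := by omega
      simp [colVar, rowVar, hi, this, extend]
    · simp [colVar, hk]
  rw [hz1, sum_addColumn (Finset.mem_range.2 (by omega)) (Finset.mem_range.2 (by omega))
    (by omega), h a b x i, ← hz, sum_principalPivot (Finset.mem_range.2 (by omega)) hA]
  by_cases hj : j = i
  · subst hj
    simp [rowVar, hz, extend, colVar, hi]
  · rw [if_neg (by omega), ← h a b x j]
    simp [rowVar, hj]

end PPPA

namespace PPPA

open Matrix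

variable {n : ℕ} {M : Matrix (Fin n) (Fin n) ℝ} {d q p : Fin n → ℝ} {u : Fin n → EReal}

/-! ### The program

Registers: `0` holds `n`, `1` the number of pivots, `3` and `4` are row and column indices, `5`
counts iterations, `6` is the pivot index. Real arrays: `0` holds the tableau, `5` the current
maximum of the ratio test, `6` the tableau after the principal pivot. -/

/-- The entry of the real array `a` in the row and column given by two registers. -/
abbrev entry (a v w : ℕ) : RExp := .get a (.reg v) (.reg w)

/-- The last column of the tableau. -/
abbrev colP : NExp := .add (.reg 0) (.const 1)

/-- The current position of the index in register `v`. -/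
abbrev position (v : ℕ) : NExp := .get 1 (.reg 1) (.reg v)

/-- Appends the columns `q` and `p = M d` to `M`. -/
def setupProg : Prog :=
  .loop 3 (.reg 0) (.seq
    (.setReal 0 (.reg 3) (.reg 0) (.get 1 (.reg 3) (.const 0)))
    (.loop 4 (.reg 0) (.setReal 0 (.reg 3) colP
      (.add (.get 0 (.reg 3) colP) (.mul (entry 0 3 4) (.get 2 (.reg 4) (.const 0)))))))

/-- The ratio of an index in `β`. -/
def lowerRatioExp : RExp := .sub .zero (.div (entry 0 3 0) (.get 0 (.reg 3) colP))

/-- The ratio of an index in `α`. -/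
def upperRatioExp : RExp :=
  -- On basic rows the tableau holds `-q̄` and `-p̄`, which accounts for the reversed signs here and
  -- in the test of `ratioStep`.
  .sub .zero (.div (.sub (.get 3 (.reg 3) (.const 0)) (entry 0 3 0))
    (.sub .zero (.get 0 (.reg 3) colP)))

/-- The current maximum of the ratio test. -/
abbrev best : RExp := .get 5 (.const 0) (.const 0)

/-- The index in register `3` attains the current maximum `e`. -/
def recordProg (e : RExp) : Prog :=
  .seq (.setReal 5 (.const 0) (.const 0) e) (.setReg 6 (.reg 3))

/-- The ratio test for the index in register `3`. -/
def ratioStep : Prog :=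
  .ite (.and (.natEq (position 3) (.const 0))
      (.and (.realLt .zero (.get 0 (.reg 3) colP)) (.realLt best lowerRatioExp)))
    (recordProg lowerRatioExp)
    (.ite (.and (.and (.natEq (position 3) (.const 1))
        (.natEq (.get 0 (.reg 3) (.const 0)) (.const 1)))
        (.and (.realLt (.get 0 (.reg 3) colP) .zero) (.realLt best upperRatioExp)))
      (recordProg upperRatioExp) .skip)

/-- The ratio test. -/
def ratioProg : Prog :=
  .seq (.setReal 5 (.const 0) (.const 0) .zero) (.loop 3 (.reg 0) ratioStep)

/-- An entry of the principal pivot. -/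
def pivotEntry : Prog :=
  .ite (.natEq (.reg 3) (.reg 6))
    (.ite (.natEq (.reg 4) (.reg 6))
      (.setReal 6 (.reg 3) (.reg 4) (.div .one (entry 0 6 6)))
      (.setReal 6 (.reg 3) (.reg 4) (.sub .zero (.div (entry 0 6 4) (entry 0 6 6)))))
    (.ite (.natEq (.reg 4) (.reg 6))
      (.setReal 6 (.reg 3) (.reg 4) (.div (entry 0 3 6) (entry 0 6 6)))
      (.setReal 6 (.reg 3) (.reg 4)
        (.sub (entry 0 3 4) (.div (.mul (entry 0 3 6) (entry 0 6 4)) (entry 0 6 6)))))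

/-- An entry of the new tableau. -/
def shiftEntry : Prog :=
  -- The position is still the one before the pivot: code `1` means that the pivot index leaves `α`
  -- for `γ`.
  .ite (.and (.natEq (.reg 4) (.reg 0)) (.natEq (position 6) (.const 1)))
    (.setReal 0 (.reg 3) (.reg 4)
      (.add (entry 6 3 4) (.mul (entry 6 3 6) (.get 3 (.reg 6) (.const 0)))))
    (.setReal 0 (.reg 3) (.reg 4) (entry 6 3 4))

/-- The update of the tableau. -/
def tableauProg : Prog :=
  .seq (.loop 3 (.reg 0) (.loop 4 (.add (.reg 0) (.const 2)) pivotEntry))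
    (.loop 3 (.reg 0) (.loop 4 (.add (.reg 0) (.const 2)) shiftEntry))

/-- The number of the next row of the record of index triples. -/
abbrev nextRow : NExp := .add (.reg 1) (.const 1)

/-- Records the next index triple. -/
def statusProg : Prog :=
  .seq (.loop 3 (.reg 0) (.setNat 1 nextRow (.reg 3) (position 3)))
    -- Both kinds of pivots that occur raise the code of the pivot index by exactly one.
    (.seq (.setNat 1 nextRow (.reg 6) (.add (position 6) (.const 1)))
      (.setReg 1 nextRow))

/-- One iteration of the algorithm. -/
def stepProg : Prog :=
  .seq ratioProg (.ite (.realLt .zero best) (.seq tableauProg statusProg) .skip)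

/-- An entry of the solution. -/
def solutionEntry : Prog :=
  .ite (.natEq (position 3) (.const 1))
    (.setReal 4 (.reg 3) (.reg 4) (entry 0 3 0))
    (.ite (.natEq (position 3) (.const 2))
      (.setReal 4 (.reg 3) (.reg 4) (.get 3 (.reg 3) (.const 0)))
      (.setReal 4 (.reg 3) (.reg 4) .zero))

/-- The algorithm. -/
def pppaProg : Prog :=
  -- The number of iterations is fixed at `2n`; once the critical value is `0`, further iterations
  -- only repeat the ratio test.
  .seq setupProg (.seq (.loop 5 (.add (.reg 0) (.reg 0)) stepProg)
    -- The inner loop of length one brings the output of a vector into the form of `exec_fill`.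
    (.loop 3 (.reg 0) (.loop 4 (.const 1) solutionEntry)))

theorem pppaProg_isPoly : pppaProg.IsPoly := by
  simp [pppaProg, setupProg, stepProg, ratioProg, ratioStep, recordProg, tableauProg, pivotEntry,
    shiftEntry, statusProg, solutionEntry, Prog.IsPoly, NExp.IsSize]

theorem pppaProg_degree : pppaProg.degree = 3 := by
  simp [pppaProg, setupProg, stepProg, ratioProg, ratioStep, recordProg, tableauProg, pivotEntry,
    shiftEntry, statusProg, solutionEntry, Prog.degree]

/-! ### Correctness of the program -/

/-- The contents of the memory during the computation; the index triples so far are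
`σ 0, …, σ N`, where register `1` holds `N`. -/
structure Represents (M : Matrix (Fin n) (Fin n) ℝ) (q p : Fin n → ℝ) (u : Fin n → EReal)
    (σ : ℕ → Status n) (m : Mem) : Prop where
  size : m.reg 0 = n
  -- No instruction writes register `2`: the report of unboundedness never occurs.
  result : m.reg 2 = 0
  flag : ∀ i : Fin n, m.nat 0 i 0 = 1 ↔ u i < ⊤
  bound : ∀ i : Fin n, m.real 3 i 0 = (u i).toReal
  run : IsRun M q p u (m.reg 1) σ
  status : ∀ k ≤ m.reg 1, ∀ i : Fin n, m.nat 1 k i = (σ k i).code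
  tableau : IsTableau M q p u (σ (m.reg 1)) (m.real 0)

theorem Represents.congr {σ : ℕ → Status n} {m m' : Mem} (h : Represents M q p u σ m)
    (hreg : ∀ v < 3, m'.reg v = m.reg v) (hnat : m'.nat = m.nat)
    (h0 : m'.real 0 = m.real 0) (h3 : m'.real 3 = m.real 3) : Represents M q p u σ m' := by
  constructor
  · rw [hreg 0 (by omega), h.size]
  · rw [hreg 2 (by omega), h.result]
  · rw [hnat]
    exact h.flag
  · rw [h3]
    exact h.bound
  · rw [hreg 1 (by omega)]
    exact h.run
  · rw [hreg 1 (by omega), hnat]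
    exact h.status
  · rw [hreg 1 (by omega), h0]
    exact h.tableau

theorem Mem.setReal_real (m : Mem) (a i j : ℕ) (x : ℝ) (k l : ℕ) :
    (m.setReal a i j x).real a k l = if k = i ∧ l = j then x else m.real a k l := by
  by_cases hk : k = i
  · subst hk
    by_cases hl : l = j
    · subst hl
      simp [Mem.setReal]
    · simp [Mem.setReal, hl]
  · simp [Mem.setReal, hk]

theorem Mem.setNat_nat (m : Mem) (a i j x k l : ℕ) :
    (m.setNat a i j x).nat a k l = if k = i ∧ l = j then x else m.nat a k l := by
  by_cases hk : k = i
  · subst hk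
    by_cases hl : l = j
    · subst hl
      simp [Mem.setNat]
    · simp [Mem.setNat, hl]
  · simp [Mem.setNat, hk]

theorem vecArray_fin (v : Fin n → ℝ) (i : Fin n) : vecArray v i 0 = v i := by
  simp [vecArray]

theorem matArray_fin (M : Matrix (Fin n) (Fin n) ℝ) (i j : Fin n) : matArray M i j = M i j := by
  simp [matArray]

theorem exec_setupProg (M : Matrix (Fin n) (Fin n) ℝ) (q d : Fin n → ℝ) (u : Fin n → EReal) :
    Represents M q (M *ᵥ d) u (fun _ => initial n) (setupProg.exec (inputMem M q d u)) ∧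
      (setupProg.exec (inputMem M q d u)).reg 1 = 0 := by
  have key : Frame 0 (inputMem M q d u) (setupProg.exec (inputMem M q d u)) ∧
      (∀ i, ∀ j < n, (setupProg.exec (inputMem M q d u)).real 0 i j = matArray M i j) ∧
      (∀ i < n, (setupProg.exec (inputMem M q d u)).real 0 i n = vecArray q i 0) ∧
      (∀ i < n, (setupProg.exec (inputMem M q d u)).real 0 i (n + 1) =
        ∑ j ∈ Finset.range n, matArray M i j * vecArray d j 0) ∧
      (∀ i, n ≤ i → (setupProg.exec (inputMem M q d u)).real 0 i (n + 1) = 0) := by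
    rw [setupProg, Prog.exec]
    refine iterate_induction (fun k m => Frame 0 (inputMem M q d u) m ∧
      (∀ i, ∀ j < n, m.real 0 i j = matArray M i j) ∧
      (∀ i < k, m.real 0 i n = vecArray q i 0) ∧
      (∀ i < k, m.real 0 i (n + 1) = ∑ j ∈ Finset.range n, matArray M i j * vecArray d j 0) ∧
      -- Column `n + 1` accumulates `Md` in place, so rows not yet treated must still hold the
      -- initial zeros.
      (∀ i, k ≤ i → m.real 0 i (n + 1) = 0)) ?_ ?_
    · exact ⟨Frame.refl _ _, fun _ _ _ => rfl, by simp, by simp,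
        fun i _ => by simp [inputMem, matArray]⟩
    · rintro k - m ⟨hF, hM, hq, hp, h0⟩
      have hF3 := hF.setReg (v := 3) (Or.inl rfl) k
      have hn3 : (m.setReg 3 k).reg 0 = n := hF3.reg 0 (by omega) (by omega)
      have h33 : (m.setReg 3 k).reg 3 = k := by simp [Mem.setReg]
      have h31 : (m.setReg 3 k).real 1 = vecArray q := hF3.real 1 (by omega)
      simp only [Prog.exec, NExp.eval, RExp.eval, hn3, h33, h31]
      set m₁ := (m.setReg 3 k).setReal 0 k n (vecArray q k 0) with hm₁
      have hF₁ : Frame 0 (inputMem M q d u) m₁ := hF3.setReal _ _ _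
      have hn₁ : m₁.reg 0 = n := hn3
      have hr₁ : ∀ i j, m₁.real 0 i j = if i = k ∧ j = n then vecArray q k 0 else m.real 0 i j :=
        fun i j => Mem.setReal_real _ _ _ _ _ _ _
      rw [hn₁]
      have := iterate_induction (N := n) (m := m₁)
        (f := fun l m' => (m'.setReg 4 l).setReal 0 ((m'.setReg 4 l).reg 3)
          ((m'.setReg 4 l).reg 0 + 1)
          ((m'.setReg 4 l).real 0 ((m'.setReg 4 l).reg 3) ((m'.setReg 4 l).reg 0 + 1) +
            (m'.setReg 4 l).real 0 ((m'.setReg 4 l).reg 3) ((m'.setReg 4 l).reg 4) *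
              (m'.setReg 4 l).real 2 ((m'.setReg 4 l).reg 4) 0))
        (fun l m' => Frame 0 (inputMem M q d u) m' ∧ m'.reg 3 = k ∧
          (∀ i, ∀ j < n, m'.real 0 i j = matArray M i j) ∧
          (∀ i < k + 1, m'.real 0 i n = vecArray q i 0) ∧
          (∀ i < k, m'.real 0 i (n + 1) =
            ∑ j ∈ Finset.range n, matArray M i j * vecArray d j 0) ∧
          m'.real 0 k (n + 1) = ∑ j ∈ Finset.range l, matArray M k j * vecArray d j 0 ∧
          (∀ i, k < i → m'.real 0 i (n + 1) = 0)) ?_ ?_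
      · obtain ⟨a1, -, a3, a4, a5, a6, a7⟩ := this
        refine ⟨a1, a3, a4, fun i hi => ?_, fun i hi => a7 i hi⟩
        rcases Nat.lt_succ_iff_lt_or_eq.1 hi with h | rfl
        exacts [a5 i h, a6]
      · refine ⟨hF₁, h33, fun i j hj => ?_, fun i hi => ?_, fun i hi => ?_, ?_, fun i hi => ?_⟩
        · rw [hr₁, if_neg (by omega), hM i j hj]
        · rw [hr₁]
          by_cases hik : i = k
          · simp [hik]
          · rw [if_neg (by omega), hq i (by omega)]
        · rw [hr₁, if_neg (by omega), hp i hi]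
        · rw [hr₁, if_neg (by omega), h0 k le_rfl]
          simp
        · rw [hr₁, if_neg (by omega), h0 i hi.le]
      · rintro l hl m' ⟨a1, a2, a3, a4, a5, a6, a7⟩
        have b1 := a1.setReg (v := 4) (Or.inr rfl) l
        have b3 : (m'.setReg 4 l).reg 3 = k := by simp [Mem.setReg, a2]
        have b4 : (m'.setReg 4 l).reg 4 = l := by simp [Mem.setReg]
        have b0 : (m'.setReg 4 l).reg 0 = n := b1.reg 0 (by omega) (by omega)
        have b2 : (m'.setReg 4 l).real 2 = vecArray d := b1.real 2 (by omega)
        have br : (m'.setReg 4 l).real 0 = m'.real 0 := rfl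
        simp only [b3, b4, b0, b2, br]
        refine ⟨b1.setReal _ _ _, b3, fun i j hj => ?_, fun i hi => ?_, fun i hi => ?_, ?_,
          fun i hi => ?_⟩
        · rw [Mem.setReal_real, if_neg (by omega), br, a3 i j hj]
        · rw [Mem.setReal_real, if_neg (by omega), br, a4 i hi]
        · rw [Mem.setReal_real, if_neg (by omega), br, a5 i hi]
        · rw [Mem.setReal_real, if_pos ⟨rfl, rfl⟩, a6, a3 k l hl, Finset.sum_range_succ]
        · rw [Mem.setReal_real, if_neg (by omega), br, a7 i hi]
  obtain ⟨hF, hM, hq, hp, -⟩ := key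
  have hreg : ∀ v < 3, (setupProg.exec (inputMem M q d u)).reg v = if v = 0 then n else 0 :=
    fun v hv => hF.reg v (by omega) (by omega)
  refine ⟨?_, by simp [hreg]⟩
  constructor
  · simp [hreg]
  · simp [hreg]
  · intro i
    rw [hF.nat]
    simp [inputMem]
  · intro i
    rw [hF.real 3 (by omega)]
    exact vecArray_fin (fun i => (u i).toReal) i
  · rw [hreg 1 (by omega)]
    exact ⟨rfl, by simp⟩
  · rw [hF.nat]
    simp [inputMem, initial, Pos.code]
  · refine IsTableau.initial (fun i j => ?_) (fun i => ?_) (fun i => ?_)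
    · rw [hM i j j.2, matArray_fin]
    · rw [hq i i.2, vecArray_fin]
    · rw [hp i i.2, Finset.sum_range]
      simp only [matArray_fin, vecArray_fin]
      rfl

theorem code_eq_zero {v : Pos} : v.code = 0 ↔ v = Pos.lower := by cases v <;> simp [Pos.code]

theorem code_eq_one {v : Pos} : v.code = 1 ↔ v = Pos.basic := by cases v <;> simp [Pos.code]

theorem code_eq_two {v : Pos} : v.code = 2 ↔ v = Pos.upper := by cases v <;> simp [Pos.code]

/-- The index `i` competes in the first ratio test with the ratio `t`. -/
def Candidate (M : Matrix (Fin n) (Fin n) ℝ) (q p : Fin n → ℝ) (u : Fin n → EReal)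
    (s : Status n) (i : Fin n) (t : ℝ) : Prop :=
  LowerRatio M q p u s i t ∨ UpperRatio M q p u s i t

theorem exec_ratioStep {σ : ℕ → Status n} {m : Mem} (h : Represents M q p u σ m)
    (hs : Regular M (σ (m.reg 1))) {i : Fin n} (hi : m.reg 3 = i) :
    (∃ t, Candidate M q p u (σ (m.reg 1)) i t ∧ m.real 5 0 0 < t ∧
      ratioStep.exec m = (m.setReal 5 0 0 t).setReg 6 i) ∨
    ((∀ t, Candidate M q p u (σ (m.reg 1)) i t → t ≤ m.real 5 0 0) ∧ ratioStep.exec m = m) := by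
  have hq := h.tableau.column_q hs i
  have hp := h.tableau.column_p hs i
  have hst := h.status _ le_rfl i
  have hfl := h.flag i
  have hb := h.bound i
  set s := σ (m.reg 1) with hsdef
  by_cases h1 : s i = Pos.lower ∧ 0 < bar M s p i ∧
      m.real 5 0 0 < -(qbar M q u s i / bar M s p i)
  · left
    refine ⟨_, Or.inl ⟨h1.1, h1.2.1, rfl⟩, h1.2.2, ?_⟩
    simp [h1.1] at hq hp
    rw [ratioStep, Prog.exec, if_pos]
    · simp [recordProg, lowerRatioExp, Prog.exec, RExp.eval, NExp.eval, hi, h.size, hq, hp]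
      simp [Mem.setReal, hi]
    · simp [Test.holds, lowerRatioExp, RExp.eval, NExp.eval, hi, h.size, hq, hp, hst, h1,
        code_eq_zero]
  by_cases h2 : s i = Pos.basic ∧ u i < ⊤ ∧ 0 < bar M s p i ∧
      m.real 5 0 0 < -(((u i).toReal + qbar M q u s i) / bar M s p i)
  · left
    refine ⟨_, Or.inr ⟨h2.1, h2.2.2.1, h2.2.1, rfl⟩, h2.2.2.2, ?_⟩
    simp [h2.1] at hq hp
    rw [ratioStep, Prog.exec, if_neg, Prog.exec, if_pos]
    · simp [recordProg, upperRatioExp, Prog.exec, RExp.eval, NExp.eval, hi, h.size, hq, hp, hb]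
      simp [Mem.setReal, hi]
    · simp [Test.holds, upperRatioExp, RExp.eval, NExp.eval, hi, h.size, hq, hp, hst, h2, hb,
        hfl.2 h2.2.1, code_eq_one]
    · simp [Test.holds, NExp.eval, hi, hst, h2, Pos.code]
  · right
    refine ⟨?_, ?_⟩
    · rintro t (⟨hl, hpos, rfl⟩ | ⟨hl, hpos, hu, rfl⟩)
      · exact not_lt.1 fun hlt => h1 ⟨hl, hpos, hlt⟩
      · exact not_lt.1 fun hlt => h2 ⟨hl, hu, hpos, hlt⟩
    · rw [ratioStep, Prog.exec, if_neg, Prog.exec, if_neg]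
      · rfl
      · rintro ⟨⟨c1, c2⟩, c3, c4⟩
        simp only [Test.holds, upperRatioExp, RExp.eval, NExp.eval, hi, h.size, hst, hb,
          code_eq_one] at c1 c2 c3 c4
        simp only [c1, if_true] at hq hp
        rw [hp] at c3
        rw [hp, hq] at c4
        simp at c3 c4
        exact h2 ⟨c1, hfl.1 c2, c3, c4⟩
      · rintro ⟨c1, c3, c4⟩
        simp only [Test.holds, lowerRatioExp, RExp.eval, NExp.eval, hi, h.size, hst,
          code_eq_zero] at c1 c3 c4
        simp [c1] at hq hp
        rw [hp] at c3
        rw [hp, hq] at c4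
        exact h1 ⟨c1, c3, by simpa using c4⟩

theorem exec_ratioProg {σ : ℕ → Status n} {m : Mem} (h : Represents M q p u σ m)
    (hs : Regular M (σ (m.reg 1))) :
    Represents M q p u σ (ratioProg.exec m) ∧ (ratioProg.exec m).reg 1 = m.reg 1 ∧
      IsCritical M q p u (σ (m.reg 1)) ((ratioProg.exec m).real 5 0 0) ∧
      (0 < (ratioProg.exec m).real 5 0 0 → ∃ i : Fin n, (ratioProg.exec m).reg 6 = i ∧
        Candidate M q p u (σ (m.reg 1)) i ((ratioProg.exec m).real 5 0 0)) := by
  have key : Represents M q p u σ (ratioProg.exec m) ∧ (ratioProg.exec m).reg 1 = m.reg 1 ∧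
      0 ≤ (ratioProg.exec m).real 5 0 0 ∧
      (∀ i : Fin n, (i : ℕ) < n → ∀ t, Candidate M q p u (σ (m.reg 1)) i t →
        t ≤ (ratioProg.exec m).real 5 0 0) ∧
      (0 < (ratioProg.exec m).real 5 0 0 → ∃ i : Fin n, (ratioProg.exec m).reg 6 = i ∧
        Candidate M q p u (σ (m.reg 1)) i ((ratioProg.exec m).real 5 0 0)) := by
    rw [ratioProg, Prog.exec, Prog.exec, Prog.exec]
    have hN : NExp.eval (m.setReal 5 (NExp.eval m (.const 0)) (NExp.eval m (.const 0))
      (RExp.eval m .zero)) (.reg 0) = n := h.size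
    rw [hN]
    refine iterate_induction (fun k m' => Represents M q p u σ m' ∧ m'.reg 1 = m.reg 1 ∧
      0 ≤ m'.real 5 0 0 ∧
      (∀ i : Fin n, (i : ℕ) < k → ∀ t, Candidate M q p u (σ (m.reg 1)) i t → t ≤ m'.real 5 0 0) ∧
      (0 < m'.real 5 0 0 → ∃ i : Fin n, m'.reg 6 = i ∧
        Candidate M q p u (σ (m.reg 1)) i (m'.real 5 0 0))) ?_ ?_
    · refine ⟨h.congr (fun _ _ => rfl) rfl rfl rfl, rfl, ?_⟩
      simp [Mem.setReal, NExp.eval, RExp.eval]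
    · rintro k hk m' ⟨hR, h1, hnn, hle, hat⟩
      have hR' : Represents M q p u σ (m'.setReg 3 k) :=
        hR.congr (fun v hv => Mem.setReg_reg_of_ne _ _ (by omega)) rfl rfl rfl
      have h1' : (m'.setReg 3 k).reg 1 = m.reg 1 := by simp [Mem.setReg, h1]
      have h6' : (m'.setReg 3 k).reg 6 = m'.reg 6 := by simp [Mem.setReg]
      have h5' : (m'.setReg 3 k).real = m'.real := rfl
      have := exec_ratioStep hR' (by rwa [h1']) (i := ⟨k, hk⟩) (by simp [Mem.setReg])
      rw [h1', h5'] at this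
      rcases this with ⟨t, ht, hlt, hex⟩ | ⟨ht, hex⟩
      · have hb : (ratioStep.exec (m'.setReg 3 k)).real 5 0 0 = t := by
          rw [hex]
          simp [Mem.setReg, Mem.setReal]
        have hr6 : (ratioStep.exec (m'.setReg 3 k)).reg 6 = k := by
          rw [hex]
          simp [Mem.setReg, Mem.setReal]
        rw [hb]
        refine ⟨?_, ?_, hnn.trans hlt.le, ?_, fun _ => ⟨⟨k, hk⟩, hr6, ht⟩⟩
        · rw [hex]
          exact hR'.congr (fun v hv => Mem.setReg_reg_of_ne _ _ (by omega)) rfl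
            (by simp [Mem.setReg, Mem.setReal]) (by simp [Mem.setReg, Mem.setReal])
        · rw [hex, Mem.setReg_reg_of_ne _ _ (by omega)]
          exact h1'
        · intro i hi t' ht'
          rcases Nat.lt_succ_iff_lt_or_eq.1 hi with hik | hik
          · exact (hle i hik t' ht').trans hlt.le
          · obtain rfl : i = ⟨k, hk⟩ := Fin.ext hik
            -- An index has at most one ratio, because the two families require different positions.
            rcases ht with ht | ht <;> rcases ht' with ht' | ht'
            · exact (ht'.2.2.trans ht.2.2.symm).le
            · exact absurd (ht.1.symm.trans ht'.1) (by simp)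
            · exact absurd (ht.1.symm.trans ht'.1) (by simp)
            · exact (ht'.2.2.2.trans ht.2.2.2.symm).le
      · rw [hex]
        refine ⟨hR', h1', hnn, ?_, by rw [h6', h5']; exact hat⟩
        intro i hi t' ht'
        rcases Nat.lt_succ_iff_lt_or_eq.1 hi with hik | hik
        · exact hle i hik t' ht'
        · obtain rfl : i = ⟨k, hk⟩ := Fin.ext hik
          exact ht t' ht'
  obtain ⟨k1, k2, k3, k4, k5⟩ := key
  refine ⟨k1, k2, ⟨?_, ?_⟩, k5⟩
  · rcases k3.lt_or_eq with hpos | h0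
    · obtain ⟨i, -, hi | hi⟩ := k5 hpos
      · exact Or.inl (Or.inr ⟨i, hi⟩)
      · exact Or.inr ⟨i, hi⟩
    · exact Or.inl (Or.inl h0.symm)
  · rintro r ((rfl | ⟨i, hi⟩) | ⟨i, hi⟩)
    exacts [k3, k4 i i.2 r (Or.inl hi), k4 i i.2 r (Or.inr hi)]

/-- The loops of `tableauProg` perform a principal pivot and, for a basic pivot index, add a
multiple of its column to column `n`. -/
theorem exec_tableauProg {m : Mem} {r : ℕ} (hr : m.reg 6 = r) (hrn : r < m.reg 0) :
    (tableauProg.exec m).nat = m.nat ∧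
      (∀ v, v ≠ 3 → v ≠ 4 → (tableauProg.exec m).reg v = m.reg v) ∧
      (tableauProg.exec m).real 3 = m.real 3 ∧
      ∀ i < m.reg 0, ∀ k < m.reg 0 + 2, (tableauProg.exec m).real 0 i k =
        if m.nat 1 (m.reg 1) r = 1 then
          addColumn (principalPivot (m.real 0) r) r (m.reg 0) (m.real 3 r 0) i k
        else principalPivot (m.real 0) r i k := by
  -- The pivot reads array `0` and writes array `6`, and a second pass copies back; thus neither
  -- pass reads the array that it fills.
  obtain ⟨hF, hB⟩ := exec_fill (c := pivotEntry) (e := .reg 0) (f := .add (.reg 0) (.const 2))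
    (a := 6) (K := m.reg 0 + 2) (m := m) (g := principalPivot (m.real 0) r)
    (fun m' hF => by simp [NExp.eval, hF.reg 0])
    (fun m' hF => by
      have h6 := (hF.reg 6 (by omega) (by omega)).trans hr
      have h0 := hF.real 0 (by omega)
      simp only [pivotEntry, Prog.exec, Test.holds, NExp.eval, RExp.eval, h6, h0]
      split_ifs with h1 h2 h2 <;> simp [principalPivot, h1, h2])
  rw [tableauProg, Prog.exec]
  set m₁ := (Prog.loop 3 (.reg 0) (.loop 4 (.add (.reg 0) (.const 2)) pivotEntry)).exec m
  have hn : m₁.reg 0 = m.reg 0 := hF.reg 0 (by omega) (by omega)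
  have h61 : m₁.reg 6 = r := (hF.reg 6 (by omega) (by omega)).trans hr
  obtain ⟨hF', hA⟩ := exec_fill (c := shiftEntry) (e := .reg 0) (f := .add (.reg 0) (.const 2))
    (a := 0) (K := m.reg 0 + 2) (m := m₁)
    (g := fun j k => if k = m.reg 0 ∧ m.nat 1 (m.reg 1) r = 1 then
      m₁.real 6 j k + m₁.real 6 j r * m.real 3 r 0 else m₁.real 6 j k)
    (fun m' hF' => by simp [NExp.eval, hF'.reg 0, hn])
    (fun m' hF' => by
      have h6 := (hF'.reg 6 (by omega) (by omega)).trans h61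
      have h0 := (hF'.reg 0 (by omega) (by omega)).trans hn
      have h1 := (hF'.reg 1 (by omega) (by omega)).trans (hF.reg 1 (by omega) (by omega))
      have h3 := (hF'.real 3 (by omega)).trans (hF.real 3 (by omega))
      have hB6 := hF'.real 6 (by omega)
      have hnat := hF'.nat.trans hF.nat
      simp only [shiftEntry, Prog.exec, Test.holds, NExp.eval, RExp.eval, h6, h0, h1, h3, hB6,
        hnat]
      split_ifs <;> rfl)
  refine ⟨hF'.nat.trans hF.nat, fun v h3 h4 => (hF'.reg v h3 h4).trans (hF.reg v h3 h4),
    (hF'.real 3 (by omega)).trans (hF.real 3 (by omega)), fun i hi k hk => ?_⟩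
  have he : NExp.eval m (.reg 0) = m.reg 0 := rfl
  have he' : NExp.eval m₁ (.reg 0) = m.reg 0 := hn
  have hr2 : r < m.reg 0 + 2 := by omega
  rw [hA, he', hB, he]
  simp only [hi, hk, hr2, and_self, if_true, addColumn]
  by_cases h1 : m.nat 1 (m.reg 1) r = 1 <;> simp [h1]

theorem exec_statusProg {m : Mem} {r : ℕ} (hr : m.reg 6 = r) :
    (statusProg.exec m).real = m.real ∧
      (∀ v, v ≠ 1 → v ≠ 3 → (statusProg.exec m).reg v = m.reg v) ∧
      (statusProg.exec m).reg 1 = m.reg 1 + 1 ∧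
      (statusProg.exec m).nat 0 = m.nat 0 ∧
      (∀ k ≤ m.reg 1, (statusProg.exec m).nat 1 k = m.nat 1 k) ∧
      ∀ i < m.reg 0, (statusProg.exec m).nat 1 (m.reg 1 + 1) i =
        if i = r then m.nat 1 (m.reg 1) i + 1 else m.nat 1 (m.reg 1) i := by
  have key := iterate_induction (N := m.reg 0) (m := m)
    (f := fun k m' => (Prog.setNat 1 nextRow (.reg 3) (position 3)).exec (m'.setReg 3 k))
    (fun k m' => m'.real = m.real ∧ (∀ v, v ≠ 3 → m'.reg v = m.reg v) ∧
      m'.nat 0 = m.nat 0 ∧ (∀ l ≤ m.reg 1, m'.nat 1 l = m.nat 1 l) ∧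
      ∀ i < k, m'.nat 1 (m.reg 1 + 1) i = m.nat 1 (m.reg 1) i) (by simp) (by
    rintro k - m' ⟨a1, a2, a3, a4, a5⟩
    have b1 : (m'.setReg 3 k).reg 1 = m.reg 1 := by simp [Mem.setReg, a2]
    have b3 : (m'.setReg 3 k).reg 3 = k := by simp [Mem.setReg]
    have bn : (m'.setReg 3 k).nat = m'.nat := rfl
    simp only [Prog.exec, NExp.eval, b1, b3, bn, a4 _ le_rfl]
    refine ⟨a1, fun v hv => (Mem.setReg_reg_of_ne _ _ hv).trans (a2 v hv), ?_, ?_, ?_⟩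
    · simp [Mem.setNat, bn, a3]
    · intro l hl
      have : l ≠ m.reg 1 + 1 := by omega
      simp [Mem.setNat, this, bn, a4 l hl]
    · intro i hi
      rw [Mem.setNat_nat]
      by_cases hik : i = k
      · simp [hik]
      · rw [if_neg (by omega), bn, a5 i (by omega)])
  rw [statusProg, Prog.exec]
  have hloop : (Prog.loop 3 (.reg 0) (.setNat 1 nextRow (.reg 3) (position 3))).exec m =
    iterate (fun k m' => (Prog.setNat 1 nextRow (.reg 3) (position 3)).exec (m'.setReg 3 k))
      (m.reg 0) m := rfl
  rw [hloop]
  set m₁ := iterate (fun k m' => (Prog.setNat 1 nextRow (.reg 3) (position 3)).exec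
    (m'.setReg 3 k)) (m.reg 0) m
  obtain ⟨a1, a2, a3, a4, a5⟩ := key
  have h61 : m₁.reg 6 = r := (a2 6 (by omega)).trans hr
  have h11 : m₁.reg 1 = m.reg 1 := a2 1 (by omega)
  simp only [Prog.exec, NExp.eval, h61, h11, a4 _ le_rfl]
  refine ⟨a1, fun v h1 h3 => (Mem.setReg_reg_of_ne _ _ h1).trans (a2 v h3), ?_, ?_, ?_, ?_⟩
  · simp [Mem.setReg, Mem.setNat, h11]
  · simp [Mem.setReg, Mem.setNat, a3]
  · intro k hk
    have : k ≠ m.reg 1 + 1 := by omega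
    simp [Mem.setReg, Mem.setNat, this, a4 k hk]
  · intro i hi
    have : ∀ v k, ((m₁.setNat 1 (m.reg 1 + 1) r (m.nat 1 (m.reg 1) r + 1)).setReg v k).nat =
      (m₁.setNat 1 (m.reg 1 + 1) r (m.nat 1 (m.reg 1) r + 1)).nat := fun _ _ => rfl
    rw [this, Mem.setNat_nat]
    by_cases hir : i = r
    · simp [hir]
    · simp [hir, a5 i hi]

/-- A run that is prolonged by one pivot. -/
theorem IsRun.snoc {N : ℕ} {σ : ℕ → Status n} (h : IsRun M q p u N σ) {κ : Kind}
    {s' : Status n} (hp : Pivot M q p u κ (σ N) s') :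
    IsRun M q p u (N + 1) fun k => if k ≤ N then σ k else s' := by
  refine ⟨by simp [h.1], fun k hk => ?_⟩
  rcases Nat.lt_succ_iff_lt_or_eq.1 hk with hk | rfl
  · simpa [hk.le, Nat.succ_le_of_lt hk] using h.2 k hk
  · exact ⟨κ, by simpa using hp⟩

/-- The condition on codes treats both pivots at once: position `lower` forces `v = basic`, position
`basic` forces `v = upper`, and `upper` is impossible. -/
theorem Represents.pivot {σ : ℕ → Status n} {m : Mem} (h : Represents M q p u σ m) {i : Fin n}
    (hi : m.reg 6 = i) {κ : Kind} {v : Pos} (hv : v.code = (σ (m.reg 1) i).code + 1)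
    (hp : Pivot M q p u κ (σ (m.reg 1)) (Function.update (σ (m.reg 1)) i v))
    (hA : m.real 0 i i ≠ 0) :
    (statusProg.exec (tableauProg.exec m)).reg 1 = m.reg 1 + 1 ∧
    Represents M q p u (fun k => if k ≤ m.reg 1 then σ k else Function.update (σ (m.reg 1)) i v)
      (statusProg.exec (tableauProg.exec m)) := by
  obtain ⟨a1, a2, a3, a4⟩ := exec_tableauProg hi (by rw [h.size]; exact i.2)
  set m₁ := tableauProg.exec m
  obtain ⟨b1, b2, b3, b4, b5, b6⟩ :=
    exec_statusProg (m := m₁) ((a2 6 (by omega) (by omega)).trans hi)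
  set m₂ := statusProg.exec m₁
  have h01 : m₁.reg 0 = n := (a2 0 (by omega) (by omega)).trans h.size
  have h11 : m₁.reg 1 = m.reg 1 := a2 1 (by omega) (by omega)
  rw [h11] at b3 b5 b6
  refine ⟨b3, ?_⟩
  have hst := h.status _ le_rfl
  constructor
  · rw [b2 0 (by omega) (by omega), h01]
  · rw [b2 2 (by omega) (by omega), a2 2 (by omega) (by omega), h.result]
  · rw [b4, a1]
    exact h.flag
  · rw [b1, a3]
    exact h.bound
  · rw [b3]
    exact h.run.snoc hp
  · rw [b3]
    intro k hk j
    by_cases hkN : k ≤ m.reg 1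
    · rw [b5 k hkN, a1, if_pos hkN]
      exact h.status k hkN j
    · obtain rfl : k = m.reg 1 + 1 := by omega
      rw [b6 j (by rw [h01]; exact j.2), a1, if_neg hkN, hst]
      by_cases hji : j = i
      · subst hji
        simp [hv]
      · rw [if_neg (by omega), Function.update_of_ne hji]
  · rw [b3, if_neg (by omega), b1]
    rw [h.size, h.bound i, hst] at a4
    cases hsi : σ (m.reg 1) i
    · obtain rfl : v = Pos.basic := by
        rw [hsi] at hv
        exact code_eq_one.1 hv
      refine (h.tableau.enter hsi hA).congr fun j hj k hk => ?_
      rw [a4 j hj k hk, hsi, if_neg (by simp [Pos.code])]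
    · obtain rfl : v = Pos.upper := by
        rw [hsi] at hv
        exact code_eq_two.1 hv
      refine (h.tableau.toUpper hsi hA).congr fun j hj k hk => ?_
      rw [a4 j hj k hk, hsi, if_pos (by simp [Pos.code])]
    · rw [hsi] at hv
      cases v <;> simp [Pos.code] at hv

theorem exec_stepProg (hM : Admissible M d) {σ : ℕ → Status n} {m : Mem}
    (h : Represents M q (M *ᵥ d) u σ m) (hs : Regular M (σ (m.reg 1))) :
    (StopsOptimal M q (M *ᵥ d) u (σ (m.reg 1)) ∧ (stepProg.exec m).reg 1 = m.reg 1 ∧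
      Represents M q (M *ᵥ d) u σ (stepProg.exec m)) ∨
    (¬ StopsOptimal M q (M *ᵥ d) u (σ (m.reg 1)) ∧ (stepProg.exec m).reg 1 = m.reg 1 + 1 ∧
      ∃ σ', Represents M q (M *ᵥ d) u σ' (stepProg.exec m)) := by
  obtain ⟨hR, h1, hc, hat⟩ := exec_ratioProg h hs
  rw [stepProg, Prog.exec, Prog.exec]
  set m₁ := ratioProg.exec m
  have hT : (Test.realLt .zero best).holds m₁ ↔ 0 < m₁.real 5 0 0 := Iff.rfl
  rw [hT]
  split_ifs with hpos
  · right
    refine ⟨fun h0 => hpos.ne (h0.unique hc), ?_⟩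
    obtain ⟨i, hi, hcand⟩ := hat hpos
    rw [← h1] at hc hcand hs ⊢
    rcases hcand with hr | hr
    · have hσ := hM.schurDiag_pos hs (by simp [hr.1]) hr.2.1
      obtain ⟨hN, hrep⟩ := hR.pivot (v := .basic) hi (by simp [hr.1, Pos.code])
        (.enter _ _ i hc hpos hr hσ) (by rw [hR.tableau.diag_of_lower hs hr.1]; exact hσ.ne')
      exact ⟨hN, _, hrep⟩
    · obtain ⟨hN, hrep⟩ := hR.pivot (v := .upper) hi (by simp [hr.1, Pos.code])
        (.toUpper _ _ i hc hpos hr) (hR.tableau.diag_of_basic hM hs hr.1)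
      exact ⟨hN, _, hrep⟩
  · left
    have h0 : m₁.real 5 0 0 = 0 :=
      le_antisymm (not_lt.1 hpos) (hc.2 (Or.inl (Or.inl rfl)))
    rw [h0] at hc
    exact ⟨hc, h1, hR⟩

theorem exec_solution {σ : ℕ → Status n} {m : Mem} (h : Represents M q p u σ m)
    (hs : Regular M (σ (m.reg 1))) :
    Frame 4 m ((Prog.loop 3 (.reg 0) (.loop 4 (.const 1) solutionEntry)).exec m) ∧
    ∀ i : Fin n, ((Prog.loop 3 (.reg 0) (.loop 4 (.const 1) solutionEntry)).exec m).real 4 i 0 =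
      solution M q u (σ (m.reg 1)) i := by
  obtain ⟨hF, hX⟩ := exec_fill (c := solutionEntry) (e := .reg 0) (f := .const 1) (a := 4)
    (K := 1) (m := m) (g := fun i _ => if m.nat 1 (m.reg 1) i = 1 then m.real 0 i (m.reg 0)
      else if m.nat 1 (m.reg 1) i = 2 then m.real 3 i 0 else 0) (fun _ _ => rfl)
    (fun m' hF => by
      have h0 := hF.reg 0 (by omega) (by omega)
      have h1 := hF.reg 1 (by omega) (by omega)
      have hr0 := hF.real 0 (by omega)
      have hr3 := hF.real 3 (by omega)
      simp only [solutionEntry, Prog.exec, Test.holds, NExp.eval, RExp.eval, h0, h1, hr0, hr3,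
        hF.nat]
      split_ifs <;> rfl)
  refine ⟨hF, fun i => ?_⟩
  have he : NExp.eval m (.reg 0) = n := h.size
  have hst := h.status _ le_rfl i
  rw [hX, he]
  dsimp only
  rw [if_pos ⟨i.2, by omega⟩, hst, h.size, h.bound i, h.tableau.column_q hs i, solution]
  cases hi : σ (m.reg 1) i <;> simp [Pos.code]

theorem documents_pppaProg (hM : Admissible M d) (hn : 0 < n) (hu : ∀ i, 0 < u i) {τ₀ : ℝ}
    (hτ : 0 < τ₀) (hq : ∀ i, 0 ≤ q i + τ₀ * (M *ᵥ d) i) :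
    Documents M q (M *ᵥ d) u (pppaProg.exec (inputMem M q d u)) := by
  obtain ⟨hsetup, hzero⟩ := exec_setupProg M q d u
  have hreach : ∀ {σ : ℕ → Status n} {m : Mem}, Represents M q (M *ᵥ d) u σ m →
      Regular M (σ (m.reg 1)) := fun h => (h.run.reachable hM hn hu hτ hq _ le_rfl).1.1
  rw [pppaProg, Prog.exec, Prog.exec]
  set m₀ := setupProg.exec (inputMem M q d u)
  have hN : NExp.eval m₀ (.add (.reg 0) (.reg 0)) = 2 * n := by
    simp only [NExp.eval, hsetup.size]
    ring
  have hloop : (Prog.loop 5 (.add (.reg 0) (.reg 0)) stepProg).exec m₀ =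
      iterate (fun k m' => stepProg.exec (m'.setReg 5 k)) (2 * n) m₀ := by
    rw [Prog.exec, hN]
  rw [hloop]
  -- Invariant: after `k` iterations either `k` pivots have been made or the algorithm has stopped.
  have hmain := iterate_induction (N := 2 * n) (m := m₀)
    (f := fun k m' => stepProg.exec (m'.setReg 5 k))
    (fun k m => ∃ σ, Represents M q (M *ᵥ d) u σ m ∧
      (m.reg 1 = k ∨ StopsOptimal M q (M *ᵥ d) u (σ (m.reg 1)))) ?_ ?_
  · set m₁ := iterate (fun k m' => stepProg.exec (m'.setReg 5 k)) (2 * n) m₀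
    obtain ⟨σ, hR, hend⟩ := hmain
    have hopt : StopsOptimal M q (M *ᵥ d) u (σ (m₁.reg 1)) := by
      refine hend.elim (fun hk => ?_) id
      refine (hM.stops_or_pivot (hreach hR)).resolve_right ?_
      -- A further pivot would give a run of `2n + 1` pivots, whose sum of codes exceeds the maximum
      -- `2n`.
      rintro ⟨κ, s', hp⟩
      have hcode := ((hR.run.snoc hp).reachable hM hn hu hτ hq _ le_rfl).2
      have hle := hcode.ge.trans (sum_code_le _)
      omega
    obtain ⟨hF, hx⟩ := exec_solution hR (hreach hR)
    refine ⟨σ, ?_⟩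
    rw [hF.reg 1 (by omega) (by omega), hF.reg 2 (by omega) (by omega), hF.nat]
    exact ⟨hR.run, hR.status, Or.inl ⟨hR.result, hopt, hx⟩⟩
  · exact ⟨_, hsetup, Or.inl hzero⟩
  · rintro k - m ⟨σ, hR, hend⟩
    have hR' : Represents M q (M *ᵥ d) u σ (m.setReg 5 k) :=
      hR.congr (fun v hv => Mem.setReg_reg_of_ne _ _ (by omega)) rfl rfl rfl
    have h1 : (m.setReg 5 k).reg 1 = m.reg 1 := Mem.setReg_reg_of_ne _ _ (by omega)
    rcases exec_stepProg hM hR' (hreach hR') with ⟨hst, hN, hrep⟩ | ⟨hst, hN, σ', hrep⟩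
    · refine ⟨σ, hrep, Or.inr ?_⟩
      rw [hN]
      exact hst
    · refine ⟨σ', hrep, Or.inl ?_⟩
      rw [h1] at hst
      rw [hN, h1, hend.resolve_right hst]

end PPPA

theorem theorem6p1 :
    ∃ (P : PPPA.Prog) (C : ℕ), ∀ (n : ℕ) (M : Matrix (Fin n) (Fin n) ℝ) (q d : Fin n → ℝ)
      (u : Fin n → EReal) (τ₀ : ℝ),
      0 < n → M.IsSymm → (PPPA.comparison M).PosSemidef → PPPA.IsIrreducible M →
      (∀ i, 0 < u i) → (∀ i, 0 < d i) → (PPPA.comparison M).mulVec d = 0 → 0 < τ₀ →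
      (∀ i, 0 ≤ q i + τ₀ * M.mulVec d i) →
      -- every run of the algorithm, however ties are broken
      (∀ (N : ℕ) (σ : ℕ → PPPA.Status n), PPPA.IsRun M q (M.mulVec d) u N σ →
        -- at most `2n` pivots, all of them diagonal
        N ≤ 2 * n ∧
        (∀ k < N, ∀ κ, PPPA.Pivot M q (M.mulVec d) u κ (σ k) (σ (k + 1)) →
          κ = PPPA.Kind.toUpper ∨ κ = PPPA.Kind.enter) ∧
        -- the linear systems of the next iteration are uniquely solvable
        IsUnit (PPPA.basicBlock M (σ N)).det ∧
        -- the algorithm stops or proceeds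
        (PPPA.StopsOptimal M q (M.mulVec d) u (σ N) ∨
          PPPA.StopsUnbounded M q (M.mulVec d) u (σ N) ∨
          ∃ κ s, PPPA.Pivot M q (M.mulVec d) u κ (σ N) s) ∧
        -- what it reports when it stops is correct
        (PPPA.StopsOptimal M q (M.mulVec d) u (σ N) →
          PPPA.IsOptimal M q u (PPPA.solution M q u (σ N))) ∧
        (PPPA.StopsUnbounded M q (M.mulVec d) u (σ N) →
          (¬ ∃ x, PPPA.IsOptimal M q u x) ∧
          ¬ BddBelow (PPPA.objective M q '' PPPA.box u))) ∧
      -- the algorithm is carried out by the program `P` in `O(n³)` steps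
      PPPA.Documents M q (M.mulVec d) u (P.exec (PPPA.inputMem M q d u)) ∧
      P.cost (PPPA.inputMem M q d u) ≤ C * n ^ 3 := by
  refine ⟨PPPA.pppaProg, PPPA.pppaProg.coef,
    fun n M q d u τ₀ hn hsymm hpsd hirr hu hd hker hτ hq => ?_⟩
  have hM : PPPA.Admissible M d := ⟨hsymm, hpsd, hirr, hd, hker⟩
  refine ⟨fun N σ hrun => ?_, PPPA.documents_pppaProg hM hn hu hτ hq, ?_⟩
  · have hreach := hrun.reachable hM hn hu hτ hq
    obtain ⟨hN, hcode⟩ := hreach N le_rfl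
    -- The number of pivots equals the sum of the codes in the last index triple.
    refine ⟨hcode ▸ PPPA.sum_code_le (σ N), fun k hk κ hp => hp.kind_eq hM (hreach k hk.le).1.1,
      hN.1, (hM.stops_or_pivot hN.1).imp_right Or.inr, hN.isOptimal hM hu,
      -- The claim about the report of unboundedness holds vacuously: under these assumptions the
      -- report never arises.
      fun hopt => absurd hopt (hM.not_stopsUnbounded hN.1)⟩
  · have := PPPA.pppaProg_isPoly.cost_le hn (m := PPPA.inputMem M q d u) (by simp [PPPA.inputMem])
    rwa [PPPA.pppaProg_degree] at this
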